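/- Setting. Let \((x,y)\) be a square-integrable random vector in \(\mathbb{R}^d\times\mathbb{R}\) such that \(H:=E(xx^T)\) is positive-definite, and let \(\theta^*\) be the solution of \(H\theta^*=E(yx)\). Assume that there are \(\sigma,R>0\) such that the matrices \(E((y-x^T\theta^*)^2xx^T)\) and \(E(\|x\|^2xx^T)\) exist and satisfy \(E((y-x^T\theta^*)^2xx^T)\preccurlyeq\sigma^2H\) and \(E(\|x\|^2xx^T)\preccurlyeq R^2H\) in the Loewner order. Let \(0<\gamma<2/R^2\), \(\delta>1\), \(\theta_0\in\mathbb{R}^d\) (deterministic), and let \(k\ge2\) and \(0\le s\le k-1\) be integers (for instance \(s=s(k)=\alpha k\) with \(0<\alpha\le1/2\), rounded to an integer). Let \((x_t,y_t)\), \(t\in\mathbb{Z}\), be independent copies of \((x,y)\). For \(m\in\mathbb{Z}\) set \(\theta_{m:m}=\theta_0\) and \(\theta_{m:t+1}=\theta_{m:t}-\gamma(x_t^T\theta_{m:t}-y_t)x_t\) for \(t\ge m\); put \(\theta_t=\theta_{0:t}\) for \(t\ge0\) and \[\bar\theta_k=\frac1{k-s}\sum_{t=s}^{k-1}\theta_t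 .\] Let \(\tau(k,0)\) be uniform on \(\{s,\dots,k-1\}\), let \(\tau(k,l)\) be uniform on \(\{k(2^l-1),\dots,k(2^{l+1}-1)-1\}\) for \(l\ge1\), and let \(N\) be a random integer with \(\Pr(N=l)=p_l:=\frac1{2^l(l+1)^\delta}-\frac1{2^{l+1}(l+2)^\delta}\) for \(l\ge0\), where \(N\), the \(\tau(k,l)\) (\(l\ge0\)) and the \((x_t,y_t)\) (\(t\in\mathbb{Z}\)) are all independent. Set \(f_{k,l}=\theta_{-\tau(k,l):0}\) and \[Z_k=\frac{f_{k,N+1}-f_{k,N}}{p_N}.\] For \(v\in\mathbb{R}^d\) let \(\|v\|_H=\|\sqrt H\,v\|\), and for a square-integrable random vector \(U\) let \(\mathrm{Var}_H(U)=E(\|\sqrt H\,U\|^2)-\|E(\sqrt H\,U)\|^2\). Proposition. The vector \(\bar\theta_k\) is integrable and \(Z_k\) is square-integrable. For integers \(n,n'\ge1\), let \(Z_k^{(1)},\dots,Z_k^{(n)}\) be copies of \(Z_k\) and \(x^{(1)},\dots,x^{(n')}\) be copies of \(x\), all of them independent, and set \(\bar Z_{k,n}=n^{-1}\sum_{i=1}^nZ_k^{(i)}\).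 Then \(\frac1{n'}\sum_{j=1}^{n'}(\bar Z_{k,n}^Tx^{(j)})^2\) is integrable and \[E\Big(\frac1{n'}\sum_{j=1}^{n'}(\bar Z_{k,n}^Tx^{(j)})^2\Big)=\|E(\bar\theta_k)-\theta^*\|_H^2+\frac{\mathrm{Var}_H(Z_k)}{n}.\] Thus, as an estimator of the squared bias \(\|E(\bar\theta_k)-\theta^*\|_H^2\), it has bias \(\mathrm{Var}_H(Z_k)/n\ge0\), and this bias tends to \(0\) as \(n\to\infty\), uniformly in \(n'\ge1\). -/

import Mathlib

open MeasureTheory ProbabilityTheory Matrix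
open scoped MatrixOrder

namespace LeastSquaresSGD

/-- `d`-dimensional real column vectors with the Euclidean norm. -/
abbrev Vec (d : ℕ) : Type := EuclideanSpace ℝ (Fin d)

noncomputable section

/-! ### Weighted norms and variances -/

/-- The vector `√S v`, where `√S` is the positive semi-definite square root of `S`. -/
def sqrtMul {d : ℕ} (S : Matrix (Fin d) (Fin d) ℝ) (v : Vec d) : Vec d :=
  WithLp.toLp 2 (CFC.sqrt S *ᵥ v.ofLp)

/-- The weighted norm `‖v‖_S = ‖√S v‖`, for a positive semi-definite matrix `S`. -/
def wnorm {d : ℕ} (S : Matrix (Fin d) (Fin d) ℝ) (v : Vec d) : ℝ :=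
  ‖sqrtMul S v‖

/-- `Var(U) = E(‖U‖²) - ‖E(U)‖²` for a square-integrable random vector `U`. -/
def vecVar {Ω : Type*} [MeasurableSpace Ω] (P : Measure Ω) {d : ℕ} (U : Ω → Vec d) : ℝ :=
  (∫ ω, ‖U ω‖ ^ 2 ∂P) - ‖∫ ω, U ω ∂P‖ ^ 2

/-- `Var_S(U) = Var(√S U)` for a square-integrable random vector `U`. -/
def wvar {Ω : Type*} [MeasurableSpace Ω] (P : Measure Ω) {d : ℕ}
    (S : Matrix (Fin d) (Fin d) ℝ) (U : Ω → Vec d) : ℝ :=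
  vecVar P (fun ω => sqrtMul S (U ω))

/-! ### The regression problem -/

/-- The matrix `E(w x xᵀ)`, for a real random weight `w` and a random vector `x`. -/
def momentMatrix {Ω : Type*} [MeasurableSpace Ω] (P : Measure Ω) {d : ℕ}
    (w : Ω → ℝ) (x : Ω → Vec d) : Matrix (Fin d) (Fin d) ℝ :=
  Matrix.of fun i j => ∫ ω, w ω * (x ω i * x ω j) ∂P

/-- All entries of the random matrix `w x xᵀ` are integrable, so that `E(w x xᵀ)` exists. -/
def MomentExists {Ω : Type*} [MeasurableSpace Ω] (P : Measure Ω) {d : ℕ}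
    (w : Ω → ℝ) (x : Ω → Vec d) : Prop :=
  ∀ i j, Integrable (fun ω => w ω * (x ω i * x ω j)) P

/-- The Hessian matrix `H = E(x xᵀ)`. -/
def hessian {Ω : Type*} [MeasurableSpace Ω] (P : Measure Ω) {d : ℕ} (x : Ω → Vec d) :
    Matrix (Fin d) (Fin d) ℝ :=
  momentMatrix P (fun _ => 1) x

/-- The data of the least squares regression: `(x, y)` is square-integrable, `H` is
positive-definite, `θ*` solves the normal equation `H θ* = E(y x)`, the matrices
`E((y - xᵀθ*)² x xᵀ)` and `E(‖x‖² x xᵀ)` exist and are at most `σ² H` and `R² H` in the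
Loewner order. -/
structure IsRegression {Ω : Type*} [MeasurableSpace Ω] (P : Measure Ω) {d : ℕ}
    (x : Ω → Vec d) (y : Ω → ℝ) (θstar : Vec d) (σ R : ℝ) : Prop where
  memLp_x : MemLp x 2 P
  memLp_y : MemLp y 2 P
  posDef : (hessian P x).PosDef
  normal_eq : WithLp.toLp 2 (hessian P x *ᵥ θstar.ofLp) = ∫ ω, y ω • x ω ∂P
  sigma_pos : 0 < σ
  R_pos : 0 < R
  noise_exists : MomentExists P (fun ω => (y ω - inner ℝ (x ω) θstar) ^ 2) x
  noise_le : (σ ^ 2 • hessian P x -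
    momentMatrix P (fun ω => (y ω - inner ℝ (x ω) θstar) ^ 2) x).PosSemidef
  fourth_exists : MomentExists P (fun ω => ‖x ω‖ ^ 2) x
  fourth_le : (R ^ 2 • hessian P x - momentMatrix P (fun ω => ‖x ω‖ ^ 2) x).PosSemidef

/-! ### Stochastic gradient descent -/

/-- `sgdIter γ θ₀ a b m n` is the value `θ_{m:m+n}`, reached after `n` steps, of the SGD
sequence started from `θ₀` at time `m` and driven by the data `(a t, b t)`, `t ∈ ℤ`. -/
def sgdIter {d : ℕ} (γ : ℝ) (θ₀ : Vec d) (a : ℤ → Vec d) (b : ℤ → ℝ) (m : ℤ) : ℕ → Vec d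
  | 0 => θ₀
  | n + 1 =>
    sgdIter γ θ₀ a b m n -
      (γ * (inner ℝ (a (m + n)) (sgdIter γ θ₀ a b m n) - b (m + n))) • a (m + n)

/-- The time-average estimator `(k - s)⁻¹ ∑_{t = s}^{k - 1} θ_t`, where `θ_t = θ_{0:t}`. -/
def timeAverage {d : ℕ} (γ : ℝ) (θ₀ : Vec d) (s k : ℕ) (a : ℤ → Vec d) (b : ℤ → ℝ) : Vec d :=
  ((k : ℝ) - (s : ℝ))⁻¹ • ∑ t ∈ Finset.Ico s k, sgdIter γ θ₀ a b 0 t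

/-- The values of `τ(k,l)`: `{s, …, k - 1}` for `l = 0` and
`{k(2^l - 1), …, k(2^(l+1) - 1) - 1}` for `l ≥ 1`. -/
def tauRange (s k : ℕ) : ℕ → Finset ℕ
  | 0 => Finset.Ico s k
  | l + 1 => Finset.Ico (k * (2 ^ (l + 1) - 1)) (k * (2 ^ (l + 2) - 1))

/-- `p_l = 1 / (2^l (l+1)^δ) - 1 / (2^(l+1) (l+2)^δ)`. -/
def levelProb (δ : ℝ) (l : ℕ) : ℝ :=
  1 / (2 ^ l * ((l : ℝ) + 1) ^ δ) - 1 / (2 ^ (l + 1) * ((l : ℝ) + 2) ^ δ)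

/-- The random inputs on `(Ω, P)`: `(xs t, ys t)`, `t ∈ ℤ`, are independent copies of `(x, y)`;
`τ l` is uniform on `tauRange s k l`; `N` takes the value `l` with probability `p_l`; and the
variables `N`, `τ l` (`l ≥ 0`) and `(xs t, ys t)` (`t ∈ ℤ`) are independent. -/
structure IsInput {Ω₀ : Type*} [MeasurableSpace Ω₀] (P₀ : Measure Ω₀)
    {Ω : Type*} [MeasurableSpace Ω] (P : Measure Ω) {d : ℕ}
    (x : Ω₀ → Vec d) (y : Ω₀ → ℝ) (s k : ℕ) (δ : ℝ)
    (xs : ℤ → Ω → Vec d) (ys : ℤ → Ω → ℝ) (τ : ℕ → Ω → ℕ) (N : Ω → ℕ) : Prop where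
  measurable_xs : ∀ t, Measurable (xs t)
  measurable_ys : ∀ t, Measurable (ys t)
  measurable_tau : ∀ l, Measurable (τ l)
  measurable_N : Measurable N
  copies : ∀ t, IdentDistrib (fun ω => (xs t ω, ys t ω)) (fun ω => (x ω, y ω)) P P₀
  tau_uniform : ∀ l, Measure.map (τ l) P = uniformOn (tauRange s k l : Set ℕ)
  N_law : ∀ l, P.real (N ⁻¹' {l}) = levelProb δ l
  indep_data : iIndepFun (fun t ω => (xs t ω, ys t ω)) P
  indep_tau : iIndepFun τ P
  indep_tau_data : IndepFun (fun ω l => τ l ω) (fun ω t => (xs t ω, ys t ω)) P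
  indep_N : IndepFun N (fun ω => (fun l => τ l ω, fun t => (xs t ω, ys t ω))) P

/-- `f_{k,l} = θ_{-τ(k,l):0}`, as a function of the data and of the value `T` of `τ(k,l)`. -/
def level {d : ℕ} (γ : ℝ) (θ₀ : Vec d) (a : ℤ → Vec d) (b : ℤ → ℝ) (T : ℕ) : Vec d :=
  sgdIter γ θ₀ a b (-(T : ℤ)) T

/-- `Z_k = (f_{k,N+1} - f_{k,N}) / p_N`. -/
def singleTerm {Ω : Type*} {d : ℕ} (γ : ℝ) (θ₀ : Vec d) (δ : ℝ)
    (xs : ℤ → Ω → Vec d) (ys : ℤ → Ω → ℝ) (τ : ℕ → Ω → ℕ) (N : Ω → ℕ) (ω : Ω) : Vec d :=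
  (levelProb δ (N ω))⁻¹ •
    (level γ θ₀ (fun t => xs t ω) (fun t => ys t ω) (τ (N ω + 1) ω) -
      level γ θ₀ (fun t => xs t ω) (fun t => ys t ω) (τ (N ω) ω))

/-! ### The estimator of the squared bias -/

/-- On `(Ω', P')`, the vectors `Zc i` are copies of `Z`, the vectors `xc j` are copies of `x`,
and all of them are independent. -/
structure IsSample {Ω₀ : Type*} [MeasurableSpace Ω₀] (P₀ : Measure Ω₀)
    {Ω : Type*} [MeasurableSpace Ω] (P : Measure Ω)
    {Ω' : Type*} [MeasurableSpace Ω'] (P' : Measure Ω') {d : ℕ}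
    (x : Ω₀ → Vec d) (Z : Ω → Vec d) {n n' : ℕ}
    (Zc : Fin n → Ω' → Vec d) (xc : Fin n' → Ω' → Vec d) : Prop where
  copies_Z : ∀ i, IdentDistrib (Zc i) Z P' P
  copies_x : ∀ j, IdentDistrib (xc j) x P' P₀
  indep : iIndepFun (Sum.elim Zc xc) P'

/-- The estimator `n'⁻¹ ∑_j (Z̄ᵀ x_j)²`, where `Z̄ = n⁻¹ ∑_i Z_i`. -/
def sqBiasEstimator {d n n' : ℕ} (z : Fin n → Vec d) (v : Fin n' → Vec d) : ℝ :=
  (n' : ℝ)⁻¹ * ∑ j, (inner ℝ ((n : ℝ)⁻¹ • ∑ i, z i) (v j)) ^ 2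

end

end LeastSquaresSGD

open LeastSquaresSGD

namespace LeastSquaresSGD

open Filter Topology
open scoped ENNReal

/-! ### Quadratic forms -/

/-! The variable `Z` is a randomised telescoping sum. Conditioning on `N` cancels the weight `p_l`,
so `E Z = ∑_l (E f_{l+1} - E f_l) = lim E f_l - E f_0`. Means along SGD obey `e ↦ (I - γH) e`, where
`e` is the error relative to `θ*`, and depend on the number of steps but not on the starting time.
Hence `E f_l → θ*`, while `E f_0`, an average over `{s, …, k-1}`, equals `E θ̄_k`. So `E Z = θ* - E
θ̄_k` is minus the bias (`IsInput.integral_singleTerm`).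

Square-integrability is a coupling from the past. The iterates `θ_{-T-1:0}` and `θ_{-T:0}` use the
same data from time `-T` on, so `y` cancels in their difference, which is multiplied by `I - γ x xᵀ`
at each step. Since `E‖v - γ x xᵀ v‖² ≤ ‖v‖² - γ(2 - γR²) vᵀHv` and `H` is positive definite, the
`L²` norm shrinks by a factor `r < 1` (`IsRegression.exists_contraction`). The increments are thus
`O(r^T)`, and `f_{l+1} - f_l` is `O(r^(2^l - 1))` in `L²`. This decay in `2^l` beats `1/p_l`, which
is only exponential in `l` up to a power (`IsInput.memLp_singleTerm`).

Finally `x_j` is independent of `Z̄`, so `E (Z̄ᵀx_j)² = E‖√H Z̄‖²`, and the mean square of an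
average of `n` independent copies is the squared mean plus the variance over `n`. -/

/-- The bilinear form `uᵀ S v`. -/
noncomputable def form {d : ℕ} (S : Matrix (Fin d) (Fin d) ℝ) (u v : Vec d) : ℝ :=
  u.ofLp ⬝ᵥ (S *ᵥ v.ofLp)

lemma inner_eq_sum {d : ℕ} (u v : Vec d) : inner ℝ u v = ∑ i, u i * v i := by
  simp [PiLp.inner_apply, mul_comm]

lemma mul_inner_mul_inner_eq_sum {d : ℕ} (c : ℝ) (x u v : Vec d) :
    c * (inner ℝ x u * inner ℝ x v) = ∑ i, ∑ j, (u i * v j) * (c * (x i * x j)) := by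
  rw [inner_eq_sum, inner_eq_sum, Finset.sum_mul_sum, Finset.mul_sum]
  refine Finset.sum_congr rfl fun i _ => ?_
  rw [Finset.mul_sum]
  exact Finset.sum_congr rfl fun j _ => by ring

lemma form_eq_sum {d : ℕ} (S : Matrix (Fin d) (Fin d) ℝ) (u v : Vec d) :
    form S u v = ∑ i, ∑ j, u i * v j * S i j := by
  simp only [form, dotProduct, mulVec, Finset.mul_sum]
  exact Finset.sum_congr rfl fun i _ => Finset.sum_congr rfl fun j _ => by ring

lemma form_eq_inner {d : ℕ} (S : Matrix (Fin d) (Fin d) ℝ) (u v : Vec d) :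
    form S u v = inner ℝ u (WithLp.toLp 2 (S *ᵥ v.ofLp)) := by
  simp [inner_eq_sum, form, dotProduct]

/-- `v ↦ √S v` as a continuous linear map. -/
noncomputable def sqrtMulL {d : ℕ} (S : Matrix (Fin d) (Fin d) ℝ) : Vec d →L[ℝ] Vec d :=
  LinearMap.toContinuousLinearMap
    { toFun := sqrtMul S
      map_add' := fun u v => by simp [sqrtMul, mulVec_add]
      map_smul' := fun c v => by simp [sqrtMul, mulVec_smul] }

lemma sqrtMulL_apply {d : ℕ} (S : Matrix (Fin d) (Fin d) ℝ) (v : Vec d) :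
    sqrtMulL S v = sqrtMul S v := rfl

lemma inner_sqrtMul {d : ℕ} {S : Matrix (Fin d) (Fin d) ℝ} (hS : S.PosSemidef) (u v : Vec d) :
    inner ℝ (sqrtMul S u) (sqrtMul S v) = form S u v := by
  have h0 : (0 : Matrix (Fin d) (Fin d) ℝ) ≤ S := hS.nonneg
  have h1 : (CFC.sqrt S)ᵀ = CFC.sqrt S := by
    have := (CFC.sqrt_nonneg S).posSemidef.isHermitian
    simpa [IsHermitian, conjTranspose_eq_transpose_of_trivial] using this
  have h2 : inner ℝ (sqrtMul S u) (sqrtMul S v) =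
      (CFC.sqrt S *ᵥ u.ofLp) ⬝ᵥ (CFC.sqrt S *ᵥ v.ofLp) := by
    simp [inner_eq_sum, dotProduct, sqrtMul]
  rw [h2, form, dotProduct_mulVec, ← mulVec_transpose, h1, mulVec_mulVec,
    CFC.sqrt_mul_sqrt_self S h0, dotProduct_mulVec, ← mulVec_transpose]
  have h3 : Sᵀ = S := by
    simpa [IsHermitian, conjTranspose_eq_transpose_of_trivial] using hS.isHermitian
  rw [h3]

lemma norm_sqrtMul_sq {d : ℕ} {S : Matrix (Fin d) (Fin d) ℝ} (hS : S.PosSemidef) (v : Vec d) :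
    ‖sqrtMul S v‖ ^ 2 = form S v v := by
  rw [← real_inner_self_eq_norm_sq, inner_sqrtMul hS]

/-- By compactness the form attains a positive minimum on the unit sphere; homogeneity does the
rest. The sphere is empty when `d = 0`, which needs a separate case. -/
lemma exists_pos_mul_norm_sq_le_form {d : ℕ} {S : Matrix (Fin d) (Fin d) ℝ} (hS : S.PosDef) :
    ∃ c : ℝ, 0 < c ∧ ∀ v : Vec d, c * ‖v‖ ^ 2 ≤ form S v v := by
  have hpos : ∀ v : Vec d, v ≠ 0 → 0 < form S v v := fun v hv => by
    have := hS.dotProduct_mulVec_pos (x := v.ofLp) (by simpa using hv)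
    simpa [form] using this
  have hcont : Continuous fun v : Vec d => form S v v := by
    simp only [form_eq_sum]
    fun_prop
  rcases (Metric.sphere (0 : Vec d) 1).eq_empty_or_nonempty with he | hne
  · refine ⟨1, one_pos, fun v => ?_⟩
    by_cases hv : v = 0
    · simp [hv, form]
    · have : ‖v‖⁻¹ • v ∈ Metric.sphere (0 : Vec d) 1 := by
        simp [norm_smul, hv]
      simp [he] at this
  · obtain ⟨u, hu, hmin⟩ := (isCompact_sphere (0 : Vec d) 1).exists_isMinOn hne hcont.continuousOn
    refine ⟨form S u u, hpos u fun h => by simp [h] at hu, fun v => ?_⟩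
    by_cases hv : v = 0
    · simp [hv, form]
    · have hmem : ‖v‖⁻¹ • v ∈ Metric.sphere (0 : Vec d) 1 := by
        simp [norm_smul, hv]
      have h1 : form S u u ≤ form S (‖v‖⁻¹ • v) (‖v‖⁻¹ • v) := hmin hmem
      have h2 : form S (‖v‖⁻¹ • v) (‖v‖⁻¹ • v) = (‖v‖ ^ 2)⁻¹ * form S v v := by
        simp only [form, WithLp.ofLp_smul, mulVec_smul, smul_dotProduct, dotProduct_smul,
          smul_eq_mul]
        ring
      have hv' : 0 < ‖v‖ ^ 2 := by positivity
      rw [h2, inv_mul_eq_div, le_div_iff₀ hv'] at h1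
      exact h1

/-! ### Moments -/

section Moments

variable {Ω : Type*} [MeasurableSpace Ω] {P : Measure Ω} {d : ℕ}

lemma MomentExists.integrable_inner_mul_inner {w : Ω → ℝ} {x : Ω → Vec d}
    (h : MomentExists P w x) (u v : Vec d) :
    Integrable (fun ω => w ω * (inner ℝ (x ω) u * inner ℝ (x ω) v)) P := by
  have e : (fun ω => w ω * (inner ℝ (x ω) u * inner ℝ (x ω) v)) =
      fun ω => ∑ i, ∑ j, (u i * v j) * (w ω * (x ω i * x ω j)) :=
    funext fun ω => mul_inner_mul_inner_eq_sum (w ω) (x ω) u v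
  rw [e]
  exact integrable_finsetSum _ fun i _ => integrable_finsetSum _ fun j _ => (h i j).const_mul _

lemma MomentExists.integral_inner_mul_inner {w : Ω → ℝ} {x : Ω → Vec d}
    (h : MomentExists P w x) (u v : Vec d) :
    ∫ ω, w ω * (inner ℝ (x ω) u * inner ℝ (x ω) v) ∂P = form (momentMatrix P w x) u v := by
  have e : (fun ω => w ω * (inner ℝ (x ω) u * inner ℝ (x ω) v)) =
      fun ω => ∑ i, ∑ j, (u i * v j) * (w ω * (x ω i * x ω j)) :=
    funext fun ω => mul_inner_mul_inner_eq_sum (w ω) (x ω) u v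
  rw [e, integral_finsetSum _ fun i _ =>
    integrable_finsetSum _ fun j _ => (h i j).const_mul _, form_eq_sum]
  refine Finset.sum_congr rfl fun i _ => ?_
  rw [integral_finsetSum _ fun j _ => (h i j).const_mul _]
  refine Finset.sum_congr rfl fun j _ => ?_
  rw [integral_const_mul]
  rfl

lemma MomentExists.integrable_mul_norm_sq {w : Ω → ℝ} {x : Ω → Vec d}
    (h : MomentExists P w x) : Integrable (fun ω => w ω * ‖x ω‖ ^ 2) P := by
  have : (fun ω => w ω * ‖x ω‖ ^ 2) = fun ω => ∑ i, w ω * (x ω i * x ω i) := by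
    ext ω
    rw [← real_inner_self_eq_norm_sq, inner_eq_sum, Finset.mul_sum]
  rw [this]
  exact integrable_finsetSum _ fun i _ => h i i

lemma momentExists_one {x : Ω → Vec d} (hx : MemLp x 2 P) : MomentExists P (fun _ => 1) x := by
  intro i j
  have h : ∀ i, MemLp (fun ω => x ω i) 2 P := fun i =>
    ((EuclideanSpace.proj i : Vec d →L[ℝ] ℝ)).comp_memLp' hx
  simpa only [one_mul] using! (h i).integrable_mul (h j)

lemma norm_integral_sq_le [IsProbabilityMeasure P] {U : Ω → Vec d} (hU : MemLp U 2 P) :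
    ‖∫ ω, U ω ∂P‖ ^ 2 ≤ ∫ ω, ‖U ω‖ ^ 2 ∂P := by
  have hi := hU.integrable one_le_two
  have h1 : Integrable (fun ω => ‖U ω‖) P := hi.norm
  have h2 := variance_nonneg (fun ω => ‖U ω‖) P
  rw [variance_eq_sub hU.norm] at h2
  have h3 := norm_integral_le_integral_norm (μ := P) U
  have h4 : ‖∫ ω, U ω ∂P‖ ^ 2 ≤ (∫ ω, ‖U ω‖ ∂P) ^ 2 := by gcongr
  simp only [Pi.pow_apply] at h2
  linarith

lemma vecVar_nonneg [IsProbabilityMeasure P] {U : Ω → Vec d} (hU : MemLp U 2 P) :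
    0 ≤ vecVar P U :=
  sub_nonneg.2 (norm_integral_sq_le hU)

end Moments

/-! ### One step of the recursion -/

section Step

variable {Ω : Type*} [MeasurableSpace Ω] {P : Measure Ω} {d : ℕ} {x : Ω → Vec d} {y : Ω → ℝ}
  {θstar : Vec d} {σ R : ℝ}

/-- The squared norm is `‖x‖² (xᵀv)²`, an entry combination of the fourth-moment matrix. -/
lemma IsRegression.memLp_inner_smul (h : IsRegression P x y θstar σ R) (v : Vec d) :
    MemLp (fun ω => (inner ℝ (x ω) v : ℝ) • x ω) 2 P := by
  have hm : AEStronglyMeasurable x P := h.memLp_x.1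
  refine (memLp_two_iff_integrable_sq_norm (by fun_prop)).2 ?_
  refine (h.fourth_exists.integrable_inner_mul_inner v v).congr (.of_forall fun ω => ?_)
  simp only [norm_smul, mul_pow, Real.norm_eq_abs, sq_abs]
  ring

/-- Splitting the residual at `θ*` as `xᵀ(v - θ*) - (y - xᵀθ*)` leaves one part to the fourth
moments and the other to the noise moments. -/
lemma IsRegression.memLp_residual_smul (h : IsRegression P x y θstar σ R) (v : Vec d) :
    MemLp (fun ω => (inner ℝ (x ω) v - y ω) • x ω) 2 P := by
  have hm : AEStronglyMeasurable x P := h.memLp_x.1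
  have hy : AEStronglyMeasurable y P := h.memLp_y.1
  have h1 : MemLp (fun ω => (y ω - inner ℝ (x ω) θstar) • x ω) 2 P := by
    refine (memLp_two_iff_integrable_sq_norm (by fun_prop)).2 ?_
    refine h.noise_exists.integrable_mul_norm_sq.congr (.of_forall fun ω => ?_)
    simp only [norm_smul, mul_pow, Real.norm_eq_abs, sq_abs]
  refine ((h.memLp_inner_smul (v - θstar)).sub h1).ae_eq (.of_forall fun ω => ?_)
  simp only [Pi.sub_apply, inner_sub_right, ← sub_smul]
  congr 1
  ring

lemma IsRegression.integral_inner_smul [IsProbabilityMeasure P]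
    (h : IsRegression P x y θstar σ R) (v : Vec d) :
    ∫ ω, (inner ℝ (x ω) v : ℝ) • x ω ∂P = WithLp.toLp 2 (hessian P x *ᵥ v.ofLp) := by
  refine ext_inner_left ℝ fun u => ?_
  have hi := (h.memLp_inner_smul v).integrable one_le_two
  rw [← integral_inner hi, ← form_eq_inner, hessian,
    ← (momentExists_one h.memLp_x).integral_inner_mul_inner]
  congr 1
  ext ω
  rw [inner_smul_right, real_inner_comm u (x ω)]
  ring

lemma IsRegression.integral_norm_sub_sq [IsProbabilityMeasure P]
    (h : IsRegression P x y θstar σ R) (γ : ℝ) (v : Vec d) :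
    ∫ ω, ‖v - (γ * inner ℝ (x ω) v) • x ω‖ ^ 2 ∂P =
      ‖v‖ ^ 2 - 2 * γ * form (hessian P x) v v +
        γ ^ 2 * form (momentMatrix P (fun ω => ‖x ω‖ ^ 2) x) v v := by
  have e : (fun ω => ‖v - (γ * inner ℝ (x ω) v) • x ω‖ ^ 2) = fun ω =>
      (‖v‖ ^ 2 - 2 * γ * (1 * (inner ℝ (x ω) v * inner ℝ (x ω) v))) +
        γ ^ 2 * (‖x ω‖ ^ 2 * (inner ℝ (x ω) v * inner ℝ (x ω) v)) := by
    ext ω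
    rw [norm_sub_sq_real, inner_smul_right, norm_smul, mul_pow, Real.norm_eq_abs, sq_abs,
      real_inner_comm (x ω) v]
    ring
  have h1 := (momentExists_one h.memLp_x).integrable_inner_mul_inner v v
  have h2 := h.fourth_exists.integrable_inner_mul_inner v v
  have h3 : Integrable (fun ω => ‖v‖ ^ 2 -
      2 * γ * (1 * (inner ℝ (x ω) v * inner ℝ (x ω) v))) P :=
    (integrable_const _).sub (h1.const_mul _)
  rw [e, integral_add h3 (h2.const_mul _), integral_sub (integrable_const _) (h1.const_mul _),
    integral_const_mul (2 * γ), integral_const_mul (γ ^ 2),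
    (momentExists_one h.memLp_x).integral_inner_mul_inner,
    h.fourth_exists.integral_inner_mul_inner]
  simp [hessian]

lemma IsRegression.exists_contraction [IsProbabilityMeasure P]
    (h : IsRegression P x y θstar σ R) {γ : ℝ} (hγ0 : 0 < γ) (hγ : γ < 2 / R ^ 2) :
    ∃ ρ : ℝ, 0 < ρ ∧ ρ < 1 ∧
      ∀ v : Vec d, ∫ ω, ‖v - (γ * inner ℝ (x ω) v) • x ω‖ ^ 2 ∂P ≤ ρ * ‖v‖ ^ 2 := by
  obtain ⟨c, hc, hcv⟩ := exists_pos_mul_norm_sq_le_form h.posDef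
  have hR : 0 < R ^ 2 := pow_pos h.R_pos 2
  have hb : 0 < γ * (2 - γ * R ^ 2) := by
    rw [lt_div_iff₀ hR] at hγ
    exact mul_pos hγ0 (by linarith)
  -- The maximum with `1/2` keeps the rate positive; `c` is only some lower bound for the form, so
  -- the other term might not be.
  refine ⟨max (1 / 2) (1 - γ * (2 - γ * R ^ 2) * c), by positivity, ?_, fun v => ?_⟩
  · have := mul_pos hb hc
    exact max_lt (by norm_num) (by linarith)
  · rw [h.integral_norm_sub_sq]
    have h1 : form (momentMatrix P (fun ω => ‖x ω‖ ^ 2) x) v v ≤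
        R ^ 2 * form (hessian P x) v v := by
      have := h.fourth_le.dotProduct_mulVec_nonneg v.ofLp
      simp only [star_trivial, sub_mulVec, smul_mulVec, dotProduct_sub, dotProduct_smul,
        smul_eq_mul] at this
      simp only [form]
      linarith
    have h2 := mul_le_mul_of_nonneg_left h1 (sq_nonneg γ)
    have h3 := mul_le_mul_of_nonneg_left (hcv v) hb.le
    calc _ ≤ (1 - γ * (2 - γ * R ^ 2) * c) * ‖v‖ ^ 2 := by linarith
      _ ≤ _ := by gcongr; exact le_max_right _ _

lemma IsRegression.memLp_sub_smul [IsProbabilityMeasure P]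
    (h : IsRegression P x y θstar σ R) (γ : ℝ) (v : Vec d) :
    MemLp (fun ω => v - (γ * inner ℝ (x ω) v) • x ω) 2 P := by
  refine ((memLp_const v).sub ((h.memLp_inner_smul v).const_smul γ)).ae_eq
    (.of_forall fun ω => ?_)
  simp [mul_smul]

/-- The mean of one step contracts. -/
lemma IsRegression.norm_sub_hessian_sq_le [IsProbabilityMeasure P]
    (h : IsRegression P x y θstar σ R) {γ ρ : ℝ}
    (hρ : ∀ v : Vec d, ∫ ω, ‖v - (γ * inner ℝ (x ω) v) • x ω‖ ^ 2 ∂P ≤ ρ * ‖v‖ ^ 2) (v : Vec d) :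
    ‖v - γ • WithLp.toLp 2 (hessian P x *ᵥ v.ofLp)‖ ^ 2 ≤ ρ * ‖v‖ ^ 2 := by
  refine le_trans (le_of_eq ?_) ((norm_integral_sq_le (h.memLp_sub_smul γ v)).trans (hρ v))
  simp only [mul_smul]
  rw [integral_sub (integrable_const _)
    (((h.memLp_inner_smul v).integrable one_le_two).fun_smul γ), integral_smul,
    h.integral_inner_smul]
  simp

lemma IsRegression.lintegral_enorm_sub_sq_le [IsProbabilityMeasure P]
    (h : IsRegression P x y θstar σ R) {γ ρ : ℝ} (hρ0 : 0 < ρ)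
    (hρ : ∀ v : Vec d, ∫ ω, ‖v - (γ * inner ℝ (x ω) v) • x ω‖ ^ 2 ∂P ≤ ρ * ‖v‖ ^ 2) (v : Vec d) :
    ∫⁻ ω, ‖v - (γ * inner ℝ (x ω) v) • x ω‖ₑ ^ 2 ∂P ≤ ENNReal.ofReal ρ * ‖v‖ₑ ^ 2 := by
  have e : ∀ u : Vec d, ‖u‖ₑ ^ 2 = ENNReal.ofReal (‖u‖ ^ 2) := fun u => by
    rw [ENNReal.ofReal_pow (norm_nonneg _), ofReal_norm]
  simp only [e]
  rw [← ofReal_integral_eq_lintegral_ofReal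
    ((memLp_two_iff_integrable_sq_norm (h.memLp_sub_smul γ v).1).1 (h.memLp_sub_smul γ v))
    (.of_forall fun _ => by positivity), ← ENNReal.ofReal_mul hρ0.le]
  exact ENNReal.ofReal_le_ofReal (hρ v)

end Step

/-! ### Copies of the data -/

section Copies

variable {Ω Ω₀ : Type*} [MeasurableSpace Ω] [MeasurableSpace Ω₀] {P : Measure Ω} {P₀ : Measure Ω₀}
  {d : ℕ} {x : Ω₀ → Vec d} {y : Ω₀ → ℝ} {a : Ω → Vec d} {b : Ω → ℝ}

lemma momentExists_congr {w : Vec d × ℝ → ℝ} (hw : Measurable w)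
    (h : IdentDistrib (fun ω => (a ω, b ω)) (fun ω => (x ω, y ω)) P P₀)
    (hx : MomentExists P₀ (fun ω => w (x ω, y ω)) x) :
    MomentExists P (fun ω => w (a ω, b ω)) a := by
  intro i j
  exact (h.comp (u := fun q : Vec d × ℝ => w q * (q.1 i * q.1 j)) (by fun_prop)).integrable_iff.2
    (hx i j)

lemma momentMatrix_congr {w : Vec d × ℝ → ℝ} (hw : Measurable w)
    (h : IdentDistrib (fun ω => (a ω, b ω)) (fun ω => (x ω, y ω)) P P₀) :
    momentMatrix P (fun ω => w (a ω, b ω)) a = momentMatrix P₀ (fun ω => w (x ω, y ω)) x := by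
  ext i j
  exact (h.comp (u := fun q : Vec d × ℝ => w q * (q.1 i * q.1 j)) (by fun_prop)).integral_eq

lemma hessian_congr (h : IdentDistrib (fun ω => (a ω, b ω)) (fun ω => (x ω, y ω)) P P₀) :
    hessian P a = hessian P₀ x :=
  momentMatrix_congr (w := fun _ => 1) measurable_const h

lemma IsRegression.of_identDistrib {θstar : Vec d} {σ R : ℝ}
    (hreg : IsRegression P₀ x y θstar σ R)
    (h : IdentDistrib (fun ω => (a ω, b ω)) (fun ω => (x ω, y ω)) P P₀) :
    IsRegression P a b θstar σ R := by
  have hw1 : Measurable fun q : Vec d × ℝ => (q.2 - inner ℝ q.1 θstar) ^ 2 := by fun_prop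
  have hw2 : Measurable fun q : Vec d × ℝ => ‖q.1‖ ^ 2 := by fun_prop
  have e1 := momentMatrix_congr hw1 h
  have e2 := momentMatrix_congr hw2 h
  refine
    { memLp_x := (h.comp measurable_fst).symm.memLp_iff.1 hreg.memLp_x
      memLp_y := (h.comp measurable_snd).symm.memLp_iff.1 hreg.memLp_y
      posDef := by rw [hessian_congr h]; exact hreg.posDef
      normal_eq := ?_
      sigma_pos := hreg.sigma_pos
      R_pos := hreg.R_pos
      noise_exists := momentExists_congr hw1 h hreg.noise_exists
      noise_le := ?_
      fourth_exists := momentExists_congr hw2 h hreg.fourth_exists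
      fourth_le := ?_ }
  · rw [hessian_congr h, hreg.normal_eq]
    exact (h.comp (u := fun q : Vec d × ℝ => q.2 • q.1) (by fun_prop)).integral_eq.symm
  · rw [hessian_congr h]
    exact e1 ▸ hreg.noise_le
  · rw [hessian_congr h]
    exact e2 ▸ hreg.fourth_le

end Copies

/-! ### The recursion along a stream of data -/

/-- `θ_{m:m+n}` as a function of the stream of data. -/
noncomputable def streamIter {d : ℕ} (γ : ℝ) (θ₀ : Vec d) (m : ℤ) (n : ℕ)
    (p : ℤ → Vec d × ℝ) : Vec d :=
  sgdIter γ θ₀ (fun t => (p t).1) (fun t => (p t).2) m n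

/-- `θ_{-T:0}` as a function of the stream of data. -/
noncomputable def streamLevel {d : ℕ} (γ : ℝ) (θ₀ : Vec d) (T : ℕ) (p : ℤ → Vec d × ℝ) : Vec d :=
  streamIter γ θ₀ (-(T : ℤ)) T p

section Stream

variable {d : ℕ} (γ : ℝ) (θ₀ : Vec d)

lemma streamIter_succ (m : ℤ) (n : ℕ) (p : ℤ → Vec d × ℝ) :
    streamIter γ θ₀ m (n + 1) p = streamIter γ θ₀ m n p -
      (γ * (inner ℝ (p (m + n)).1 (streamIter γ θ₀ m n p) - (p (m + n)).2)) • (p (m + n)).1 :=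
  rfl

lemma measurable_streamIter (m : ℤ) (n : ℕ) : Measurable (streamIter γ θ₀ m n) := by
  induction n with
  | zero => exact measurable_const
  | succ n ih =>
    have h : Measurable fun p : ℤ → Vec d × ℝ => p (m + n) := measurable_pi_apply _
    simp only [funext fun p => streamIter_succ γ θ₀ m n p]
    fun_prop

lemma measurable_streamLevel (T : ℕ) : Measurable (streamLevel γ θ₀ T) :=
  measurable_streamIter γ θ₀ _ T

lemma dependsOn_streamIter (m : ℤ) (n : ℕ) :
    DependsOn (streamIter γ θ₀ m n) (Finset.Ico m (m + n) : Finset ℤ) := by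
  induction n with
  | zero => exact fun _ _ _ => rfl
  | succ n ih =>
    intro p q h
    have h1 : streamIter γ θ₀ m n p = streamIter γ θ₀ m n q := ih fun i hi => h i (by
      simp only [Finset.coe_Ico, Set.mem_Ico] at hi ⊢
      push_cast
      omega)
    have h2 : p (m + n) = q (m + n) := h _ (by
      simp only [Finset.coe_Ico, Set.mem_Ico]
      push_cast
      omega)
    rw [streamIter_succ, streamIter_succ, h1, h2]

end Stream

/-! ### Independence of past and present -/

section Indep

variable {Ω ι E F G : Type*} [MeasurableSpace Ω] {P : Measure Ω} [MeasurableSpace E]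
  [MeasurableSpace F]

lemma indepFun_of_dependsOn [Inhabited E] {X : ι → Ω → E} (hX : iIndepFun X P)
    (hm : ∀ i, AEMeasurable (X i) P) {S : Finset ι} {t : ι} (ht : t ∉ S) {f : (ι → E) → F}
    (hf : Measurable f) (hS : DependsOn f S) : IndepFun (fun ω => f fun i => X i ω) (X t) P := by
  classical
  have h1 := hX.indepFun_finset₀ S {t} (by simpa using ht) hm
  -- Coordinates outside `S` get an arbitrary value, which `f` does not see; thus `f` factors
  -- through the restriction to `S`.
  let ext : (S → E) → ι → E := fun z i => if h : i ∈ S then z ⟨i, h⟩ else default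
  have hext : Measurable ext := measurable_pi_lambda _ fun i => by
    by_cases h : i ∈ S
    · simpa [ext, h] using measurable_pi_apply _
    · simp [ext, h]
  have h2 := h1.comp (hf.comp hext)
    (measurable_pi_apply (⟨t, Finset.mem_singleton_self t⟩ : ({t} : Finset ι)))
  refine h2.congr (.of_forall fun ω => ?_) (.of_forall fun ω => rfl)
  exact hS fun i hi => by simp [ext, Finset.mem_coe.1 hi]

lemma measurable_countable_comp [MeasurableSpace G] {N : Ω → ℕ} {Y : Ω → F} (hN : Measurable N)
    (hY : Measurable Y) {g : ℕ → F → G} (hg : ∀ n, Measurable (g n)) :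
    Measurable fun ω => g (N ω) (Y ω) := by
  have h : Measurable (Function.uncurry g) := measurable_from_prod_countable_right hg
  exact h.comp (hN.prodMk hY)

/-- Tonelli for the product law. It lets a bound proved for a fixed vector be applied to a random
vector independent of the present datum, with no integrability to check. -/
lemma lintegral_indepFun [IsFiniteMeasure P] {X : Ω → E} {Y : Ω → F} (h : IndepFun X Y P)
    (hX : Measurable X) (hY : Measurable Y) {g : E → F → ℝ≥0∞}
    (hg : Measurable (Function.uncurry g)) :
    ∫⁻ ω, g (X ω) (Y ω) ∂P = ∫⁻ ω, ∫⁻ ω', g (X ω) (Y ω') ∂P ∂P := by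
  have h1 := (indepFun_iff_map_prod_eq_prod_map_map hX.aemeasurable hY.aemeasurable).1 h
  have h2 : ∫⁻ ω, g (X ω) (Y ω) ∂P = ∫⁻ q, Function.uncurry g q ∂(P.map fun ω => (X ω, Y ω)) := by
    rw [lintegral_map hg (hX.prodMk hY)]
    rfl
  rw [h2, h1, lintegral_prod _ hg.aemeasurable, lintegral_map hg.lintegral_prod_right' hX]
  refine lintegral_congr fun ω => ?_
  rw [lintegral_map (f := fun y => Function.uncurry g (X ω, y)) (by fun_prop) hY]
  rfl

lemma lintegral_countable_indepFun [IsFiniteMeasure P] {N : Ω → ℕ} {Y : Ω → F}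
    (h : IndepFun N Y P) (hN : Measurable N) (hY : Measurable Y) {g : ℕ → F → ℝ≥0∞}
    (hg : ∀ n, Measurable (g n)) :
    ∫⁻ ω, g (N ω) (Y ω) ∂P = ∑' n, P (N ⁻¹' {n}) * ∫⁻ ω, g n (Y ω) ∂P := by
  have hg' : Measurable (Function.uncurry g) := measurable_from_prod_countable_right hg
  rw [lintegral_indepFun h hN hY hg',
    ← lintegral_map (f := fun n => ∫⁻ ω, g n (Y ω) ∂P) (Measurable.of_discrete) hN,
    lintegral_countable']
  refine tsum_congr fun n => ?_
  rw [Measure.map_apply hN (measurableSet_singleton n), mul_comm]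

/-- The events `N = n` partition the space; on each, `N` is frozen and independence factors out its
probability. -/
lemma hasSum_integral_indepFun [IsProbabilityMeasure P] [NormedAddCommGroup G] [NormedSpace ℝ G]
    [CompleteSpace G] [MeasurableSpace G] [BorelSpace G] [SecondCountableTopology G]
    {N : Ω → ℕ} {Y : Ω → F}
    (h : IndepFun N Y P) (hN : Measurable N) (hY : Measurable Y) {g : ℕ → F → G}
    (hg : ∀ n, Measurable (g n)) (hi : Integrable (fun ω => g (N ω) (Y ω)) P) :
    HasSum (fun n => P.real (N ⁻¹' {n}) • ∫ ω, g n (Y ω) ∂P) (∫ ω, g (N ω) (Y ω) ∂P) := by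
  have h1 := hasSum_integral_iUnion (μ := P) (s := fun n => N ⁻¹' {n})
    (f := fun ω => g (N ω) (Y ω)) (fun n => hN (measurableSet_singleton n))
    (fun i j hij => Set.disjoint_left.2 fun ω hi hj => hij (by
      simp only [Set.mem_preimage, Set.mem_singleton_iff] at hi hj
      rw [← hi, ← hj])) hi.integrableOn
  have h2 : ⋃ n, N ⁻¹' {n} = Set.univ := by
    ext ω
    simp
  rw [h2, setIntegral_univ] at h1
  refine h1.congr_fun fun n => ?_
  have h3 : ∫ ω in N ⁻¹' {n}, g (N ω) (Y ω) ∂P = ∫ ω in N ⁻¹' {n}, g n (Y ω) ∂P :=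
    setIntegral_congr_fun (hN (measurableSet_singleton n)) fun ω hω => by
      simp only [Set.mem_preimage, Set.mem_singleton_iff] at hω
      simp only [hω]
  rw [h3, Indep.setIntegral_eq_smul hN.comap_le ((IndepFun_iff_Indep _ _ _).1 h) hY.aemeasurable
    ⟨{n}, measurableSet_singleton n, rfl⟩ (hg n).aestronglyMeasurable]

end Indep

/-! ### Mean and mean square along the recursion -/

section Recursion

variable {Ω : Type*} [MeasurableSpace Ω] {P : Measure Ω} {d : ℕ}
  {θstar : Vec d} {σ R : ℝ}

lemma IsRegression.lintegral_sub_smul_le [IsProbabilityMeasure P] {a : Ω → Vec d} {b : Ω → ℝ}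
    (h : IsRegression P a b θstar σ R) (ha : Measurable a) {γ ρ : ℝ} (hρ0 : 0 < ρ)
    (hρ : ∀ v : Vec d, ∫ ω, ‖v - (γ * inner ℝ (a ω) v) • a ω‖ ^ 2 ∂P ≤ ρ * ‖v‖ ^ 2)
    {D : Ω → Vec d} (hD : Measurable D) (hi : IndepFun D a P) :
    ∫⁻ ω, ‖D ω - (γ * inner ℝ (a ω) (D ω)) • a ω‖ₑ ^ 2 ∂P ≤
      ENNReal.ofReal ρ * ∫⁻ ω, ‖D ω‖ₑ ^ 2 ∂P := by
  rw [lintegral_indepFun (g := fun v u : Vec d => ‖v - (γ * inner ℝ u v) • u‖ₑ ^ 2) hi hD ha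
    (by unfold Function.uncurry; fun_prop), ← lintegral_const_mul _ (by fun_prop)]
  exact lintegral_mono fun ω => h.lintegral_enorm_sub_sq_le hρ0 hρ (D ω)

lemma continuous_rankOne_self {d : ℕ} :
    Continuous fun u : Vec d => InnerProductSpace.rankOne ℝ u u :=
  isBoundedBilinearMap_apply.continuous.comp
    ((InnerProductSpace.rankOne (F := Vec d) (E := Vec d) ℝ).continuous.prodMk continuous_id)

lemma integrable_rankOne {a : Ω → Vec d} (ha : MemLp a 2 P) :
    Integrable (fun ω => InnerProductSpace.rankOne ℝ (a ω) (a ω)) P := by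
  have hm : AEStronglyMeasurable a P := ha.1
  refine ((memLp_two_iff_integrable_sq_norm hm).1 ha).mono'
    (continuous_rankOne_self.comp_aestronglyMeasurable hm) (.of_forall fun ω => ?_)
  rw [InnerProductSpace.norm_rankOne, sq]

/-- The vector `a aᵀ D` is bilinear in `D` and the operator `a aᵀ`, which are independent, so its
mean is `E(a aᵀ) E(D)`. Integrability of both factors suffices, so `D` need not be
square-integrable. -/
lemma IsRegression.integrable_inner_smul_indep [IsProbabilityMeasure P] {a : Ω → Vec d} {b : Ω → ℝ}
    (h : IsRegression P a b θstar σ R)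
    {D : Ω → Vec d} (hD : Integrable D P) (hi : IndepFun D a P) :
    Integrable (fun ω => (inner ℝ (a ω) (D ω) : ℝ) • a ω) P ∧
      ∫ ω, (inner ℝ (a ω) (D ω) : ℝ) • a ω ∂P =
        WithLp.toLp 2 (hessian P a *ᵥ (∫ ω, D ω ∂P).ofLp) := by
  have hM := integrable_rankOne h.memLp_x
  have hi' : IndepFun D (fun ω => InnerProductSpace.rankOne ℝ (a ω) (a ω)) P :=
    hi.comp (φ := id) measurable_id continuous_rankOne_self.measurable
  let B : Vec d →L[ℝ] (Vec d →L[ℝ] Vec d) →L[ℝ] Vec d := ContinuousLinearMap.apply ℝ (Vec d)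
  have e : (fun ω => (inner ℝ (a ω) (D ω) : ℝ) • a ω) =
      fun ω => B (D ω) (InnerProductSpace.rankOne ℝ (a ω) (a ω)) := by
    ext1 ω
    simp [B]
  rw [e]
  refine ⟨hi'.integrable_bilin hD hM B, ?_⟩
  rw [hi'.integral_bilin hD hM B]
  simp only [B, ContinuousLinearMap.apply_apply]
  rw [ContinuousLinearMap.integral_apply hM, ← h.integral_inner_smul]
  simp

/-- The deterministic recursion satisfied by the means `E(θ_{m:m+n})`. -/
noncomputable def meanIter {d : ℕ} (γ : ℝ) (θ₀ θstar : Vec d) (H : Matrix (Fin d) (Fin d) ℝ) :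
    ℕ → Vec d
  | 0 => θ₀
  | n + 1 => meanIter γ θ₀ θstar H n -
      γ • WithLp.toLp 2 (H *ᵥ (meanIter γ θ₀ θstar H n - θstar).ofLp)

lemma norm_meanIter_sub_sq_le {γ ρ : ℝ} {θ₀ : Vec d} {H : Matrix (Fin d) (Fin d) ℝ}
    (hρ0 : 0 < ρ)
    (hρ : ∀ v : Vec d, ‖v - γ • WithLp.toLp 2 (H *ᵥ v.ofLp)‖ ^ 2 ≤ ρ * ‖v‖ ^ 2) (n : ℕ) :
    ‖meanIter γ θ₀ θstar H n - θstar‖ ^ 2 ≤ ρ ^ n * ‖θ₀ - θstar‖ ^ 2 := by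
  induction n with
  | zero => simp [meanIter]
  | succ n ih =>
    have e : meanIter γ θ₀ θstar H (n + 1) - θstar = (meanIter γ θ₀ θstar H n - θstar) -
        γ • WithLp.toLp 2 (H *ᵥ (meanIter γ θ₀ θstar H n - θstar).ofLp) := by
      simp only [meanIter]
      abel
    rw [e, pow_succ' ρ, mul_assoc]
    exact (hρ _).trans (by gcongr)

variable {X : ℤ → Ω → Vec d × ℝ} {γ : ℝ} {θ₀ : Vec d} {H : Matrix (Fin d) (Fin d) ℝ}

lemma indepFun_streamIter (hX : iIndepFun X P) (hm : ∀ t, Measurable (X t)) (m : ℤ) (n : ℕ) :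
    IndepFun (fun ω => streamIter γ θ₀ m n fun t => X t ω) (X (m + n)) P :=
  indepFun_of_dependsOn hX (fun t => (hm t).aemeasurable) (S := Finset.Ico m (m + n)) (by simp)
    (measurable_streamIter γ θ₀ m n) (dependsOn_streamIter γ θ₀ m n)

/-- The mean does not involve `m`. This identifies `E θ_{-n:0}` with `E θ_{0:n}`, hence level 0 with
the time average. -/
lemma integrable_streamIter [IsProbabilityMeasure P] (hX : iIndepFun X P)
    (hm : ∀ t, Measurable (X t))
    (hreg : ∀ t, IsRegression P (fun ω => (X t ω).1) (fun ω => (X t ω).2) θstar σ R)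
    (hH : ∀ t, hessian P (fun ω => (X t ω).1) = H) (m : ℤ) (n : ℕ) :
    Integrable (fun ω => streamIter γ θ₀ m n fun t => X t ω) P ∧
      ∫ ω, streamIter γ θ₀ m n (fun t => X t ω) ∂P = meanIter γ θ₀ θstar H n := by
  induction n with
  | zero =>
    constructor
    · exact integrable_const θ₀
    · simp [streamIter, sgdIter, meanIter]
  | succ n ih =>
    obtain ⟨h1, h2⟩ := ih
    obtain ⟨h3, h4⟩ := (hreg (m + n)).integrable_inner_smul_indep h1
      ((indepFun_streamIter hX hm m n).comp (φ := id) measurable_id measurable_fst)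
    -- At `v = 0` the residual vector is `-y x`.
    have h5 : Integrable (fun ω => (X (m + n) ω).2 • (X (m + n) ω).1) P := by
      refine (((hreg (m + n)).memLp_inner_smul 0).integrable one_le_two).sub
        (((hreg (m + n)).memLp_residual_smul 0).integrable one_le_two) |>.congr
          (.of_forall fun ω => ?_)
      simp
    have e : (fun ω => streamIter γ θ₀ m (n + 1) fun t => X t ω) = fun ω =>
        streamIter γ θ₀ m n (fun t => X t ω) -
          γ • ((inner ℝ (X (m + n) ω).1 (streamIter γ θ₀ m n fun t => X t ω) : ℝ) •
            (X (m + n) ω).1 - (X (m + n) ω).2 • (X (m + n) ω).1) := by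
      ext1 ω
      rw [streamIter_succ, ← sub_smul, smul_smul]
    have h6 : Integrable (fun ω => (inner ℝ (X (m + n) ω).1
        (streamIter γ θ₀ m n fun t => X t ω) : ℝ) • (X (m + n) ω).1 -
          (X (m + n) ω).2 • (X (m + n) ω).1) P := h3.sub h5
    rw [e]
    refine ⟨h1.sub (h6.fun_smul γ), ?_⟩
    rw [integral_sub h1 (h6.fun_smul γ), integral_smul, integral_sub h3 h5, h4, h2,
      ← (hreg (m + n)).normal_eq, hH, meanIter]
    simp [mulVec_sub]

/-- The effect of one more step in the past. -/
lemma lintegral_streamIter_sub_le [IsProbabilityMeasure P] (hX : iIndepFun X P)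
    (hm : ∀ t, Measurable (X t))
    (hreg : ∀ t, IsRegression P (fun ω => (X t ω).1) (fun ω => (X t ω).2) θstar σ R)
    {ρ : ℝ} (hρ0 : 0 < ρ)
    (hρ : ∀ t, ∀ v : Vec d,
      ∫ ω, ‖v - (γ * inner ℝ (X t ω).1 v) • (X t ω).1‖ ^ 2 ∂P ≤ ρ * ‖v‖ ^ 2) (m : ℤ) (n : ℕ) :
    ∫⁻ ω, ‖streamIter γ θ₀ m (n + 1) (fun t => X t ω) -
        streamIter γ θ₀ (m + 1) n (fun t => X t ω)‖ₑ ^ 2 ∂P ≤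
      ENNReal.ofReal ρ ^ n * ∫⁻ ω, ‖(γ * (inner ℝ (X m ω).1 θ₀ - (X m ω).2)) • (X m ω).1‖ₑ ^ 2 ∂P
      := by
  induction n with
  | zero =>
    simp [streamIter, sgdIter]
  | succ n ih =>
    -- The difference of the two coupled iterates uses only the data at times `m, …, m + n`, so it
    -- is independent of the datum at `m + n + 1`.
    let F : (ℤ → Vec d × ℝ) → Vec d := fun p =>
      streamIter γ θ₀ m (n + 1) p - streamIter γ θ₀ (m + 1) n p
    have hF : Measurable F :=
      (measurable_streamIter γ θ₀ m (n + 1)).sub (measurable_streamIter γ θ₀ (m + 1) n)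
    have hS : DependsOn F (Finset.Ico m (m + (n + 1 : ℕ)) : Finset ℤ) := by
      intro p q h
      have h1 := dependsOn_streamIter γ θ₀ m (n + 1) h
      have h2 := dependsOn_streamIter γ θ₀ (m + 1) n (x := p) (y := q) fun i hi => h i (by
        simp only [Finset.coe_Ico, Set.mem_Ico] at hi ⊢
        push_cast
        omega)
      simp only [F, h1, h2]
    have hind := (indepFun_of_dependsOn hX (fun t => (hm t).aemeasurable) (t := m + (n + 1 : ℕ))
      (by simp) hF hS).comp (φ := id) measurable_id measurable_fst
    have hmX : Measurable fun ω => fun t => X t ω := measurable_pi_lambda _ hm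
    have h1 := (hreg (m + (n + 1 : ℕ))).lintegral_sub_smul_le (hm _).fst hρ0 (hρ _)
      (hF.comp hmX) hind
    rw [pow_succ', mul_assoc]
    refine le_trans (le_of_eq ?_) (h1.trans (by gcongr; exact ih))
    refine lintegral_congr fun ω => ?_
    -- Both iterates take their next step with the same datum; its `y` cancels, leaving the
    -- homogeneous recursion.
    rw [streamIter_succ γ θ₀ m (n + 1), streamIter_succ γ θ₀ (m + 1) n]
    have e : m + 1 + (n : ℤ) = m + ((n + 1 : ℕ) : ℤ) := by push_cast; ring
    rw [e]
    simp only [F, Function.comp_apply, inner_sub_right]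
    congr 2
    module

end Recursion

/-! ### Level probabilities and ranges -/

/-- Replacing `(l+2)^δ` by the smaller `(l+1)^δ` turns the subtracted term into exactly half of the
first. -/
lemma one_div_le_levelProb {δ : ℝ} (hδ : 1 < δ) (l : ℕ) :
    1 / (2 ^ (l + 1) * ((l : ℝ) + 1) ^ δ) ≤ levelProb δ l := by
  have h1 : 0 < ((l : ℝ) + 1) ^ δ := by positivity
  have h2 : ((l : ℝ) + 1) ^ δ ≤ ((l : ℝ) + 2) ^ δ := by gcongr; norm_num
  have h3 : 1 / (2 ^ (l + 1) * ((l : ℝ) + 2) ^ δ) ≤ 1 / (2 ^ (l + 1) * ((l : ℝ) + 1) ^ δ) := by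
    gcongr
  have h4 : 1 / (2 ^ l * ((l : ℝ) + 1) ^ δ) = 2 * (1 / (2 ^ (l + 1) * ((l : ℝ) + 1) ^ δ)) := by
    field_simp
    ring
  rw [levelProb, h4]
  linarith

lemma levelProb_pos {δ : ℝ} (hδ : 1 < δ) (l : ℕ) : 0 < levelProb δ l :=
  lt_of_lt_of_le (by positivity) (one_div_le_levelProb hδ l)

lemma inv_levelProb_le {δ : ℝ} (hδ : 1 < δ) (l : ℕ) :
    (levelProb δ l)⁻¹ ≤ 2 ^ (l + 1) * ((l : ℝ) + 1) ^ δ := by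
  have h := one_div_le_levelProb hδ l
  rw [one_div] at h
  exact inv_le_of_inv_le₀ (by positivity) h

/-- Up to a constant the terms are at most `n^(⌈δ⌉+1) r^n` at `n = 2^l`, a subseries of a convergent
series. -/
lemma summable_inv_levelProb_mul_pow {δ r : ℝ} (hδ : 1 < δ) (hr0 : 0 < r) (hr1 : r < 1) :
    Summable fun l : ℕ => (levelProb δ l)⁻¹ * r ^ (2 ^ l - 1) := by
  have h1 := (summable_pow_mul_geometric_of_norm_lt_one (⌈δ⌉₊ + 1) (r := r)
    (by rwa [Real.norm_of_nonneg hr0.le])).comp_injective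
      (Nat.pow_right_injective (le_refl 2))
  refine (h1.mul_left (2 * r⁻¹)).of_nonneg_of_le (fun l => ?_) fun l => ?_
  · have := levelProb_pos hδ l
    positivity
  · have h2 : ((l : ℝ) + 1) ^ δ ≤ ((2 : ℝ) ^ l) ^ ⌈δ⌉₊ := by
      have h3 : (l : ℝ) + 1 ≤ 2 ^ l := by exact_mod_cast Nat.lt_two_pow_self (n := l)
      calc ((l : ℝ) + 1) ^ δ ≤ ((2 : ℝ) ^ l) ^ δ := by gcongr
        _ ≤ ((2 : ℝ) ^ l) ^ (⌈δ⌉₊ : ℝ) :=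
          Real.rpow_le_rpow_of_exponent_le (one_le_pow₀ one_le_two) (Nat.le_ceil δ)
        _ = _ := Real.rpow_natCast _ _
    have h4 : r ^ (2 ^ l - 1) = r⁻¹ * r ^ 2 ^ l := by
      rw [pow_sub₀ r hr0.ne' Nat.one_le_two_pow, pow_one, mul_comm]
    calc (levelProb δ l)⁻¹ * r ^ (2 ^ l - 1)
        ≤ (2 ^ (l + 1) * ((2 : ℝ) ^ l) ^ ⌈δ⌉₊) * (r⁻¹ * r ^ 2 ^ l) := by
          rw [h4]
          gcongr
          exact (inv_levelProb_le hδ l).trans (by gcongr)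
      _ = _ := by
          simp only [Function.comp_apply, Nat.cast_pow, Nat.cast_ofNat]
          ring

lemma le_of_mem_tauRange {s k l m : ℕ} (h : m ∈ tauRange s k l) : k * (2 ^ l - 1) ≤ m := by
  cases l with
  | zero => simp
  | succ l => exact (Finset.mem_Ico.1 h).1

/-- With `le_of_mem_tauRange`, this orders consecutive ranges, so that `τ l ≤ τ (l + 1)` almost
surely. -/
lemma lt_of_mem_tauRange {s k l m : ℕ} (h : m ∈ tauRange s k l) : m < k * (2 ^ (l + 1) - 1) := by
  cases l with
  | zero => simpa using (Finset.mem_Ico.1 h).2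
  | succ l => exact (Finset.mem_Ico.1 h).2

lemma tauRange_nonempty {s k : ℕ} (hs : s < k) (l : ℕ) : (tauRange s k l).Nonempty := by
  cases l with
  | zero => exact Finset.nonempty_Ico.2 hs
  | succ l =>
    refine Finset.nonempty_Ico.2 (Nat.mul_lt_mul_of_pos_left ?_ (by omega))
    have h1 : 1 ≤ 2 ^ (l + 1) := Nat.one_le_two_pow
    rw [pow_succ 2 (l + 1)]
    omega

lemma two_pow_sub_one_le {s k : ℕ} (hs : s < k) (l : ℕ) : 2 ^ l - 1 ≤ k * (2 ^ l - 1) :=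
  Nat.le_mul_of_pos_left _ (by omega)

/-! ### Uniform random indices -/

section Uniform

variable {Ω : Type*} [MeasurableSpace Ω] {P : Measure Ω} {T : Ω → ℕ} {S : Finset ℕ}

lemma real_preimage_of_map_eq_uniformOn (hT : Measurable T)
    (h : P.map T = uniformOn (S : Set ℕ)) (m : ℕ) :
    P.real (T ⁻¹' {m}) = if m ∈ S then (S.card : ℝ)⁻¹ else 0 := by
  have h1 : P (T ⁻¹' {m}) = uniformOn (S : Set ℕ) (({m} : Finset ℕ) : Set ℕ) := by
    rw [← h, Finset.coe_singleton, Measure.map_apply hT (measurableSet_singleton m)]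
  rw [Measure.real, h1, uniformOn_apply_finset, Finset.inter_singleton]
  split_ifs <;> simp

lemma ae_mem_of_map_eq_uniformOn (hT : Measurable T) (h : P.map T = uniformOn (S : Set ℕ)) :
    ∀ᵐ ω ∂P, T ω ∈ S := by
  have h1 : ∀ᵐ m ∂(P.map T), m ∈ S := by
    rw [h, ae_iff]
    refine (uniformOn_eq_zero_iff S.finite_toSet).2 ?_
    ext m
    simp +contextual
  exact ae_of_ae_map hT.aemeasurable h1

end Uniform

/-! ### Distances between levels -/

section Levels

variable {Ω : Type*} [MeasurableSpace Ω] {P : Measure Ω} {d : ℕ}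
  {θstar : Vec d} {σ R : ℝ} {X : ℤ → Ω → Vec d × ℝ} {γ : ℝ} {θ₀ : Vec d}

lemma eLpNorm_two_sq {E : Type*} [NormedAddCommGroup E] (f : Ω → E) :
    eLpNorm f 2 P ^ 2 = ∫⁻ ω, ‖f ω‖ₑ ^ 2 ∂P := by
  have := eLpNorm_nnreal_pow_eq_lintegral (μ := P) (f := f) (p := 2) two_ne_zero
  simpa using this

/-- The constant is the `L²` size of the first step from `θ₀`, made at time `-T-1`; as the data are
identically distributed, it is the same for every `T`. -/
lemma eLpNorm_streamLevel_succ_sub_le [IsProbabilityMeasure P] (hX : iIndepFun X P)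
    (hm : ∀ t, Measurable (X t)) (hid : ∀ t, IdentDistrib (X t) (X 0) P P)
    (hreg : ∀ t, IsRegression P (fun ω => (X t ω).1) (fun ω => (X t ω).2) θstar σ R)
    {r : ℝ} (hr0 : 0 < r)
    (hr : ∀ t, ∀ v : Vec d,
      ∫ ω, ‖v - (γ * inner ℝ (X t ω).1 v) • (X t ω).1‖ ^ 2 ∂P ≤ r ^ 2 * ‖v‖ ^ 2) :
    ∃ C : ℝ≥0∞, C ≠ ∞ ∧ ∀ T : ℕ,
      eLpNorm (fun ω => streamLevel γ θ₀ (T + 1) (fun t => X t ω) -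
        streamLevel γ θ₀ T (fun t => X t ω)) 2 P ≤ C * ENNReal.ofReal r ^ T := by
  let u : Vec d × ℝ → Vec d := fun q => (γ * (inner ℝ q.1 θ₀ - q.2)) • q.1
  have hu : Measurable u := by fun_prop
  have hL : MemLp (u ∘ X 0) 2 P := by
    refine (((hreg 0).memLp_residual_smul θ₀).const_smul γ).ae_eq (.of_forall fun ω => ?_)
    simp [u, mul_smul]
  refine ⟨eLpNorm (u ∘ X 0) 2 P, hL.eLpNorm_ne_top, fun T => ?_⟩
  have h1 := lintegral_streamIter_sub_le (θ₀ := θ₀) hX hm hreg (pow_pos hr0 2) hr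
    (-((T + 1 : ℕ) : ℤ)) T
  have e : -((T + 1 : ℕ) : ℤ) + 1 = -(T : ℤ) := by push_cast; ring
  rw [e] at h1
  have h2 : ∫⁻ ω, ‖u (X (-((T + 1 : ℕ) : ℤ)) ω)‖ₑ ^ 2 ∂P = eLpNorm (u ∘ X 0) 2 P ^ 2 := by
    rw [← ((hid (-((T + 1 : ℕ) : ℤ))).comp hu).eLpNorm_eq 2, eLpNorm_two_sq]
    rfl
  rw [← ENNReal.pow_le_pow_left_iff two_ne_zero, eLpNorm_two_sq, mul_pow, mul_comm, ← h2,
    pow_right_comm, ← ENNReal.ofReal_pow hr0.le]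
  exact h1

lemma sum_Ico_pow_le (q : ℝ≥0∞) (a b : ℕ) : ∑ m ∈ Finset.Ico a b, q ^ m ≤ q ^ a * (1 - q)⁻¹ := by
  rw [Finset.sum_Ico_eq_sum_range, ← ENNReal.tsum_geometric]
  simp only [pow_add, ← Finset.mul_sum]
  gcongr
  exact ENNReal.sum_le_tsum _

/-- The telescoping sum from `T₁` to `T₂` is bounded pathwise by the norms of all increments in
`[lo, hi)`, so no independence of the random times is needed. The bound `hi` only makes the sum
finite. -/
lemma eLpNorm_streamLevel_sub_le [IsProbabilityMeasure P] (hm : ∀ t, Measurable (X t))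
    {C q : ℝ≥0∞}
    (hC : ∀ T : ℕ, eLpNorm (fun ω => streamLevel γ θ₀ (T + 1) (fun t => X t ω) -
        streamLevel γ θ₀ T (fun t => X t ω)) 2 P ≤ C * q ^ T)
    {T₁ T₂ : Ω → ℕ} {lo hi : ℕ} (h1 : ∀ᵐ ω ∂P, lo ≤ T₁ ω) (h2 : ∀ᵐ ω ∂P, T₁ ω ≤ T₂ ω)
    (h3 : ∀ᵐ ω ∂P, T₂ ω ≤ hi) :
    eLpNorm (fun ω => streamLevel γ θ₀ (T₂ ω) (fun t => X t ω) -
      streamLevel γ θ₀ (T₁ ω) (fun t => X t ω)) 2 P ≤ C * (q ^ lo * (1 - q)⁻¹) := by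
  let g : ℕ → Ω → Vec d := fun m ω => streamLevel γ θ₀ (m + 1) (fun t => X t ω) -
        streamLevel γ θ₀ m (fun t => X t ω)
  have hmX : Measurable fun ω => fun t => X t ω := measurable_pi_lambda _ hm
  have hg : ∀ m, Measurable (g m) := fun m =>
    ((measurable_streamLevel γ θ₀ (m + 1)).comp hmX).sub
      ((measurable_streamLevel γ θ₀ m).comp hmX)
  have hle : ∀ᵐ ω ∂P, ‖streamLevel γ θ₀ (T₂ ω) (fun t => X t ω) -
      streamLevel γ θ₀ (T₁ ω) (fun t => X t ω)‖ ≤ (∑ m ∈ Finset.Ico lo hi, fun ω => ‖g m ω‖) ω := by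
    filter_upwards [h1, h2, h3] with ω h1 h2 h3
    have := dist_le_Ico_sum_dist (fun T => streamLevel γ θ₀ T (fun t => X t ω)) h2
    rw [dist_comm, dist_eq_norm] at this
    rw [Finset.sum_apply]
    refine this.trans ?_
    refine (Finset.sum_le_sum_of_subset_of_nonneg (Finset.Ico_subset_Ico h1 h3)
      fun _ _ _ => dist_nonneg).trans (le_of_eq ?_)
    exact Finset.sum_congr rfl fun m _ => by rw [dist_comm, dist_eq_norm]
  calc _ ≤ eLpNorm (∑ m ∈ Finset.Ico lo hi, fun ω => ‖g m ω‖) 2 P := eLpNorm_mono_ae_real hle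
    _ ≤ ∑ m ∈ Finset.Ico lo hi, eLpNorm (fun ω => ‖g m ω‖) 2 P :=
      eLpNorm_sum_le (fun m _ => (hg m).norm.aestronglyMeasurable) one_le_two
    _ ≤ ∑ m ∈ Finset.Ico lo hi, C * q ^ m :=
      Finset.sum_le_sum fun m _ => by rw [eLpNorm_norm]; exact hC m
    _ ≤ _ := by rw [← Finset.mul_sum]; gcongr; exact sum_Ico_pow_le q lo hi

end Levels

/-! ### The single term estimator -/

section Input

variable {Ω₀ : Type*} [MeasurableSpace Ω₀] {P₀ : Measure Ω₀}
  {Ω : Type*} [MeasurableSpace Ω] {P : Measure Ω}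
  {d : ℕ} {x : Ω₀ → Vec d} {y : Ω₀ → ℝ} {θstar θ₀ : Vec d} {σ R γ δ : ℝ} {k s : ℕ}
  {xs : ℤ → Ω → Vec d} {ys : ℤ → Ω → ℝ} {τ : ℕ → Ω → ℕ} {N : Ω → ℕ}

/-- The stream of data. -/
def stream (xs : ℤ → Ω → Vec d) (ys : ℤ → Ω → ℝ) (t : ℤ) (ω : Ω) : Vec d × ℝ := (xs t ω, ys t ω)


/-- `(f_{k,l+1} - f_{k,l}) / p_l` as a function of the values of the `τ(k,l)` and of the data. -/
noncomputable def levelDiff (γ : ℝ) (θ₀ : Vec d) (δ : ℝ) (l : ℕ)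
    (q : (ℕ → ℕ) × (ℤ → Vec d × ℝ)) : Vec d :=
  (levelProb δ l)⁻¹ • (streamLevel γ θ₀ (q.1 (l + 1)) q.2 - streamLevel γ θ₀ (q.1 l) q.2)

lemma measurable_levelDiff (l : ℕ) :
    Measurable (levelDiff γ θ₀ δ l) := by
  have h : ∀ l, Measurable fun q : (ℕ → ℕ) × (ℤ → Vec d × ℝ) =>
      streamLevel γ θ₀ (q.1 l) q.2 := fun l =>
    measurable_countable_comp (g := streamLevel γ θ₀)
      (N := fun q : (ℕ → ℕ) × (ℤ → Vec d × ℝ) => q.1 l) (by fun_prop) measurable_snd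
      (measurable_streamLevel γ θ₀)
  exact ((h (l + 1)).sub (h l)).const_smul (levelProb δ l)⁻¹

lemma singleTerm_eq {Ω : Type*} {xs : ℤ → Ω → Vec d} {ys : ℤ → Ω → ℝ} {τ : ℕ → Ω → ℕ}
    {N : Ω → ℕ} : singleTerm γ θ₀ δ xs ys τ N =
    fun ω => levelDiff γ θ₀ δ (N ω) (fun l => τ l ω, fun t => stream xs ys t ω) := rfl

lemma IsInput.measurable_stream (hin : IsInput P₀ P x y s k δ xs ys τ N) (t : ℤ) :
    Measurable (stream xs ys t) :=
  (hin.measurable_xs t).prodMk (hin.measurable_ys t)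

lemma IsInput.measurable_stream_pi (hin : IsInput P₀ P x y s k δ xs ys τ N) :
    Measurable fun ω t => stream xs ys t ω :=
  measurable_pi_lambda _ hin.measurable_stream

lemma IsInput.measurable_pair (hin : IsInput P₀ P x y s k δ xs ys τ N) :
    Measurable fun ω => (fun l => τ l ω, fun t => stream xs ys t ω) :=
  (measurable_pi_lambda _ hin.measurable_tau).prodMk hin.measurable_stream_pi

lemma IsInput.measurable_singleTerm (hin : IsInput P₀ P x y s k δ xs ys τ N) :
    Measurable (singleTerm γ θ₀ δ xs ys τ N) := by
  rw [singleTerm_eq]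
  exact measurable_countable_comp (g := levelDiff γ θ₀ δ) hin.measurable_N hin.measurable_pair
    measurable_levelDiff

lemma IsInput.exists_rate [IsProbabilityMeasure P₀]
    (hin : IsInput P₀ P x y s k δ xs ys τ N)
    (hreg : IsRegression P₀ x y θstar σ R) (hγ0 : 0 < γ) (hγ : γ < 2 / R ^ 2) :
    ∃ r : ℝ, 0 < r ∧ r < 1 ∧
      (∀ t, ∀ v : Vec d, ∫ ω, ‖v - (γ * inner ℝ (stream xs ys t ω).1 v) •
        (stream xs ys t ω).1‖ ^ 2 ∂P ≤ r ^ 2 * ‖v‖ ^ 2) ∧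
      ∀ v : Vec d, ‖v - γ • WithLp.toLp 2 (hessian P₀ x *ᵥ v.ofLp)‖ ^ 2 ≤ r ^ 2 * ‖v‖ ^ 2 := by
  obtain ⟨ρ, h0, h1, hρ⟩ := hreg.exists_contraction hγ0 hγ
  refine ⟨√ρ, Real.sqrt_pos.2 h0, by rwa [Real.sqrt_lt' one_pos, one_pow], ?_, ?_⟩
  · intro t v
    rw [Real.sq_sqrt h0.le]
    refine le_of_eq_of_le ?_ (hρ v)
    exact ((hin.copies t).comp
      (u := fun q : Vec d × ℝ => ‖v - (γ * inner ℝ q.1 v) • q.1‖ ^ 2) (by fun_prop)).integral_eq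
  · intro v
    rw [Real.sq_sqrt h0.le]
    exact hreg.norm_sub_hessian_sq_le hρ v

variable [IsProbabilityMeasure P]

lemma IsInput.integrable_streamIter (hin : IsInput P₀ P x y s k δ xs ys τ N)
    (hreg : IsRegression P₀ x y θstar σ R) (m : ℤ) (n : ℕ) :
    Integrable (fun ω => streamIter γ θ₀ m n fun t => stream xs ys t ω) P ∧
      ∫ ω, streamIter γ θ₀ m n (fun t => stream xs ys t ω) ∂P =
        meanIter γ θ₀ θstar (hessian P₀ x) n :=
  LeastSquaresSGD.integrable_streamIter hin.indep_data hin.measurable_stream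
    (fun t => hreg.of_identDistrib (hin.copies t)) (fun t => hessian_congr (hin.copies t)) m n

lemma IsInput.integrable_level (hin : IsInput P₀ P x y s k δ xs ys τ N)
    (hreg : IsRegression P₀ x y θstar σ R) (l : ℕ) :
    Integrable (fun ω => streamLevel γ θ₀ (τ l ω) fun t => stream xs ys t ω) P := by
  have hmeas : Measurable fun ω => streamLevel γ θ₀ (τ l ω) fun t => stream xs ys t ω :=
    measurable_countable_comp (hin.measurable_tau l) hin.measurable_stream_pi
      (measurable_streamLevel γ θ₀)
  have hi : Integrable (fun ω => ∑ m ∈ tauRange s k l,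
      ‖streamLevel γ θ₀ m fun t => stream xs ys t ω‖) P :=
    integrable_finsetSum _ fun m _ => (hin.integrable_streamIter hreg _ m).1.norm
  refine hi.mono' hmeas.aestronglyMeasurable ?_
  filter_upwards [ae_mem_of_map_eq_uniformOn (hin.measurable_tau l) (hin.tau_uniform l)] with ω hω
  exact Finset.single_le_sum
    (f := fun m => ‖streamLevel γ θ₀ m fun t => stream xs ys t ω‖)
    (fun _ _ => norm_nonneg _) hω

lemma IsInput.integral_level (hin : IsInput P₀ P x y s k δ xs ys τ N)
    (hreg : IsRegression P₀ x y θstar σ R) (l : ℕ) :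
    ∫ ω, streamLevel γ θ₀ (τ l ω) (fun t => stream xs ys t ω) ∂P =
      ∑ m ∈ tauRange s k l,
        ((tauRange s k l).card : ℝ)⁻¹ • meanIter γ θ₀ θstar (hessian P₀ x) m := by
  have hind : IndepFun (τ l) (fun ω t => stream xs ys t ω) P :=
    hin.indep_tau_data.comp (φ := fun z : ℕ → ℕ => z l) (ψ := id)
      (measurable_pi_apply l) measurable_id
  have h1 := hasSum_integral_indepFun (g := fun m p => streamLevel γ θ₀ m p) hind
    (hin.measurable_tau l) hin.measurable_stream_pi (fun m => measurable_streamLevel γ θ₀ m)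
    (hin.integrable_level hreg l)
  have h2 : ∀ m, ∫ ω, streamLevel γ θ₀ m (fun t => stream xs ys t ω) ∂P =
      meanIter γ θ₀ θstar (hessian P₀ x) m := fun m => (hin.integrable_streamIter hreg _ m).2
  simp only [h2, real_preimage_of_map_eq_uniformOn (hin.measurable_tau l) (hin.tau_uniform l)]
    at h1
  refine h1.unique ?_
  have h3 : HasSum (fun m => (if m ∈ tauRange s k l then ((tauRange s k l).card : ℝ)⁻¹ else 0) •
      meanIter γ θ₀ θstar (hessian P₀ x) m) _ :=
    hasSum_sum_of_ne_finset_zero (s := tauRange s k l) fun m hm => by simp [hm]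
  have h4 : ∑ m ∈ tauRange s k l, (if m ∈ tauRange s k l then
      ((tauRange s k l).card : ℝ)⁻¹ else 0) • meanIter γ θ₀ θstar (hessian P₀ x) m =
      ∑ m ∈ tauRange s k l,
        ((tauRange s k l).card : ℝ)⁻¹ • meanIter γ θ₀ θstar (hessian P₀ x) m :=
    Finset.sum_congr rfl fun m hm => by rw [if_pos hm]
  rwa [h4] at h3

lemma IsInput.integrable_timeAverage (hin : IsInput P₀ P x y s k δ xs ys τ N)
    (hreg : IsRegression P₀ x y θstar σ R) :
    Integrable (fun ω => timeAverage γ θ₀ s k (fun t => xs t ω) (fun t => ys t ω)) P :=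
  (integrable_finsetSum _ fun n _ => (hin.integrable_streamIter hreg 0 n).1).smul
    ((k : ℝ) - (s : ℝ))⁻¹

/-- Both sides average the same means over `{s, …, k-1}`: on the left by summation over time, on the
right by the uniform law of `τ 0`. -/
lemma IsInput.integral_timeAverage (hin : IsInput P₀ P x y s k δ xs ys τ N)
    (hreg : IsRegression P₀ x y θstar σ R) (hs : s < k) :
    ∫ ω, timeAverage γ θ₀ s k (fun t => xs t ω) (fun t => ys t ω) ∂P =
      ∫ ω, streamLevel γ θ₀ (τ 0 ω) (fun t => stream xs ys t ω) ∂P := by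
  have h1 : ∫ ω, timeAverage γ θ₀ s k (fun t => xs t ω) (fun t => ys t ω) ∂P =
      ∫ ω, ((k : ℝ) - (s : ℝ))⁻¹ •
        ∑ n ∈ Finset.Ico s k, streamIter γ θ₀ 0 n (fun t => stream xs ys t ω) ∂P := rfl
  rw [h1, integral_smul, integral_finsetSum _ fun n _ => (hin.integrable_streamIter hreg 0 n).1,
    hin.integral_level hreg, ← Finset.smul_sum]
  simp only [tauRange, Nat.card_Ico, Nat.cast_sub hs.le]
  congr 1
  exact Finset.sum_congr rfl fun n _ => (hin.integrable_streamIter hreg 0 n).2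

variable [IsProbabilityMeasure P₀]

lemma IsInput.tendsto_integral_level (hin : IsInput P₀ P x y s k δ xs ys τ N)
    (hreg : IsRegression P₀ x y θstar σ R) (hγ0 : 0 < γ) (hγ : γ < 2 / R ^ 2) (hs : s < k) :
    Tendsto (fun l => ∫ ω, streamLevel γ θ₀ (τ l ω) (fun t => stream xs ys t ω) ∂P) atTop
      (𝓝 θstar) := by
  obtain ⟨r, hr0, hr1, -, hr⟩ := hin.exists_rate hreg hγ0 hγ
  have hb : ∀ l, ‖(∫ ω, streamLevel γ θ₀ (τ l ω) (fun t => stream xs ys t ω) ∂P) - θstar‖ ≤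
      r ^ l * ‖θ₀ - θstar‖ := by
    intro l
    rw [hin.integral_level hreg l, ← mem_closedBall_iff_norm]
    have hc : ((tauRange s k l).card : ℝ) ≠ 0 := by
      exact_mod_cast (Finset.card_pos.2 (tauRange_nonempty hs l)).ne'
    -- The mean of a level is a convex combination of mean iterates after `m ≥ l` steps, all in one
    -- ball around `θ*`.
    refine (convex_closedBall θstar _).sum_mem (fun _ _ => by positivity)
      (by simp [hc]) fun m hm => ?_
    rw [mem_closedBall_iff_norm, ← pow_le_pow_iff_left₀ (norm_nonneg _) (by positivity)
      two_ne_zero]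
    refine (norm_meanIter_sub_sq_le (pow_pos hr0 2) hr m).trans ?_
    have hlm : l ≤ m := by
      have h1 := le_of_mem_tauRange hm
      have h2 := two_pow_sub_one_le hs l
      have h3 := Nat.lt_two_pow_self (n := l)
      omega
    rw [mul_pow, pow_right_comm]
    gcongr ?_ ^ 2 * _
    exact pow_le_pow_of_le_one hr0.le hr1.le hlm
  rw [tendsto_iff_norm_sub_tendsto_zero]
  refine squeeze_zero (fun _ => norm_nonneg _) hb ?_
  simpa using (tendsto_pow_atTop_nhds_zero_of_lt_one hr0.le hr1).mul_const ‖θ₀ - θstar‖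

lemma IsInput.exists_eLpNorm_levelDiff_le (hin : IsInput P₀ P x y s k δ xs ys τ N)
    (hreg : IsRegression P₀ x y θstar σ R) (hγ0 : 0 < γ) (hγ : γ < 2 / R ^ 2) (hs : s < k) :
    ∃ (r : ℝ) (C : ℝ≥0∞), 0 < r ∧ r < 1 ∧ C ≠ ∞ ∧ ∀ l : ℕ,
      eLpNorm (fun ω => streamLevel γ θ₀ (τ (l + 1) ω) (fun t => stream xs ys t ω) -
        streamLevel γ θ₀ (τ l ω) (fun t => stream xs ys t ω)) 2 P ≤
          C * ENNReal.ofReal r ^ (2 ^ l - 1) := by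
  obtain ⟨r, hr0, hr1, hr, -⟩ := hin.exists_rate hreg hγ0 hγ
  obtain ⟨C, hC, hCT⟩ := eLpNorm_streamLevel_succ_sub_le (θ₀ := θ₀) hin.indep_data
    hin.measurable_stream (fun t => (hin.copies t).trans (hin.copies 0).symm)
    (fun t => hreg.of_identDistrib (hin.copies t)) hr0 hr
  have hq : ENNReal.ofReal r < 1 := by simpa using hr1
  refine ⟨r, C * (1 - ENNReal.ofReal r)⁻¹, hr0, hr1,
    ENNReal.mul_ne_top hC (ENNReal.inv_ne_top.2 (tsub_pos_of_lt hq).ne'), fun l => ?_⟩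
  have hmem := fun l => ae_mem_of_map_eq_uniformOn (hin.measurable_tau l) (hin.tau_uniform l)
  have h1 : ∀ᵐ ω ∂P, 2 ^ l - 1 ≤ τ l ω := by
    filter_upwards [hmem l] with ω h
    exact (two_pow_sub_one_le hs l).trans (le_of_mem_tauRange h)
  have h2 : ∀ᵐ ω ∂P, τ l ω ≤ τ (l + 1) ω := by
    filter_upwards [hmem l, hmem (l + 1)] with ω h h'
    exact (lt_of_mem_tauRange h).le.trans (le_of_mem_tauRange h')
  have h3 : ∀ᵐ ω ∂P, τ (l + 1) ω ≤ k * (2 ^ (l + 1 + 1) - 1) := by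
    filter_upwards [hmem (l + 1)] with ω h
    exact (lt_of_mem_tauRange h).le
  rw [mul_right_comm, mul_assoc]
  exact eLpNorm_streamLevel_sub_le hin.measurable_stream hCT h1 h2 h3

/-- Conditioning on `N` gives `E‖Z‖² = ∑_l p_l⁻¹ E‖f_{l+1} - f_l‖²`, one factor `p_l` cancelling
against `p_l⁻²`. -/
lemma IsInput.memLp_singleTerm (hin : IsInput P₀ P x y s k δ xs ys τ N)
    (hreg : IsRegression P₀ x y θstar σ R) (hγ0 : 0 < γ) (hγ : γ < 2 / R ^ 2) (hδ : 1 < δ)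
    (hs : s < k) : MemLp (singleTerm γ θ₀ δ xs ys τ N) 2 P := by
  obtain ⟨r, C, hr0, hr1, hC, h⟩ := hin.exists_eLpNorm_levelDiff_le (θ₀ := θ₀) hreg hγ0 hγ hs
  refine ⟨hin.measurable_singleTerm.aestronglyMeasurable, ?_⟩
  suffices h : eLpNorm (singleTerm γ θ₀ δ xs ys τ N) 2 P ^ 2 < ∞ from
    (ENNReal.pow_lt_top_iff.1 h).resolve_right two_ne_zero
  rw [eLpNorm_two_sq]
  have h1 := lintegral_countable_indepFun (g := fun l q => ‖levelDiff γ θ₀ δ l q‖ₑ ^ 2) hin.indep_N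
    hin.measurable_N hin.measurable_pair (fun l => (measurable_levelDiff l).enorm.pow_const 2)
  rw [singleTerm_eq]
  refine (h1.trans_le (ENNReal.tsum_le_tsum fun l => ?_)).trans_lt
    (b := ∑' l, C ^ 2 * ENNReal.ofReal ((levelProb δ l)⁻¹ * r ^ (2 ^ l - 1))) ?_
  · have hp := levelProb_pos hδ l
    have hN : P (N ⁻¹' {l}) = ENNReal.ofReal (levelProb δ l) := by
      rw [← hin.N_law l, ofReal_measureReal]
    have h2 : eLpNorm (fun ω => levelDiff γ θ₀ δ l (fun l => τ l ω, fun t => stream xs ys t ω)) 2 P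
        ≤ ENNReal.ofReal (levelProb δ l)⁻¹ * (C * ENNReal.ofReal r ^ (2 ^ l - 1)) := by
      have h3 := eLpNorm_const_smul (levelProb δ l)⁻¹
        (fun ω => streamLevel γ θ₀ (τ (l + 1) ω) (fun t => stream xs ys t ω) -
          streamLevel γ θ₀ (τ l ω) (fun t => stream xs ys t ω)) 2 P
      rw [Real.enorm_of_nonneg (inv_nonneg.2 hp.le)] at h3
      refine (le_of_eq h3).trans ?_
      gcongr
      exact h l
    calc _ = ENNReal.ofReal (levelProb δ l) * eLpNorm (fun ω => levelDiff γ θ₀ δ l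
          (fun l => τ l ω, fun t => stream xs ys t ω)) 2 P ^ 2 := by
          rw [eLpNorm_two_sq, hN]
          rfl
      _ ≤ ENNReal.ofReal (levelProb δ l) *
          (ENNReal.ofReal (levelProb δ l)⁻¹ * (C * ENNReal.ofReal r ^ (2 ^ l - 1))) ^ 2 := by
        gcongr
      _ = C ^ 2 * ENNReal.ofReal ((levelProb δ l)⁻¹ * (r ^ (2 ^ l - 1)) ^ 2) := by
        have e : (levelProb δ l)⁻¹ * (r ^ (2 ^ l - 1)) ^ 2 =
            levelProb δ l * ((levelProb δ l)⁻¹ ^ 2 * (r ^ (2 ^ l - 1)) ^ 2) := by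
          field_simp
        rw [e, ENNReal.ofReal_mul hp.le, ENNReal.ofReal_mul (by positivity),
          ENNReal.ofReal_pow (by positivity), ENNReal.ofReal_pow (by positivity),
          ENNReal.ofReal_pow hr0.le]
        ring
      _ ≤ _ := by
        gcongr
        -- The square of the geometric factor is given up: the first power already gives a summable
        -- series.
        exact pow_le_of_le_one (by positivity) (pow_le_one₀ hr0.le hr1.le) two_ne_zero
  · rw [ENNReal.tsum_mul_left]
    exact ENNReal.mul_lt_top (ENNReal.pow_lt_top hC.lt_top)
      (summable_inv_levelProb_mul_pow hδ hr0 hr1).tsum_ofReal_lt_top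

lemma IsInput.integral_singleTerm (hin : IsInput P₀ P x y s k δ xs ys τ N)
    (hreg : IsRegression P₀ x y θstar σ R) (hγ0 : 0 < γ) (hγ : γ < 2 / R ^ 2) (hδ : 1 < δ)
    (hs : s < k) : ∫ ω, singleTerm γ θ₀ δ xs ys τ N ω ∂P =
      θstar - ∫ ω, streamLevel γ θ₀ (τ 0 ω) (fun t => stream xs ys t ω) ∂P := by
  have hL := hin.memLp_singleTerm (θ₀ := θ₀) hreg hγ0 hγ hδ hs
  have h1 := hasSum_integral_indepFun (g := levelDiff γ θ₀ δ) hin.indep_N hin.measurable_N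
    hin.measurable_pair measurable_levelDiff (hL.integrable one_le_two)
  have h2 : ∀ l, P.real (N ⁻¹' {l}) •
      ∫ ω, levelDiff γ θ₀ δ l (fun l => τ l ω, fun t => stream xs ys t ω) ∂P =
      (∫ ω, streamLevel γ θ₀ (τ (l + 1) ω) (fun t => stream xs ys t ω) ∂P) -
        ∫ ω, streamLevel γ θ₀ (τ l ω) (fun t => stream xs ys t ω) ∂P := by
    intro l
    simp only [levelDiff]
    rw [integral_smul, hin.N_law, smul_inv_smul₀ (levelProb_pos hδ l).ne',
      integral_sub (hin.integrable_level hreg (l + 1)) (hin.integrable_level hreg l)]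
  have h3 := (h1.congr_fun fun l => (h2 l).symm).tendsto_sum_nat
  refine tendsto_nhds_unique h3 ?_
  have h4 : ∀ n, ∑ l ∈ Finset.range n,
      ((∫ ω, streamLevel γ θ₀ (τ (l + 1) ω) (fun t => stream xs ys t ω) ∂P) -
        ∫ ω, streamLevel γ θ₀ (τ l ω) (fun t => stream xs ys t ω) ∂P) =
      (∫ ω, streamLevel γ θ₀ (τ n ω) (fun t => stream xs ys t ω) ∂P) -
        ∫ ω, streamLevel γ θ₀ (τ 0 ω) (fun t => stream xs ys t ω) ∂P := fun n =>
    Finset.sum_range_sub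
      (fun l => ∫ ω, streamLevel γ θ₀ (τ l ω) (fun t => stream xs ys t ω) ∂P) n
  simp only [h4]
  exact (hin.tendsto_integral_level hreg hγ0 hγ hs).sub_const _

end Input

/-! ### Sample means and the estimator of the squared bias -/

section Sample

variable {Ω Ω' : Type*} [MeasurableSpace Ω] [MeasurableSpace Ω'] {P : Measure Ω} {P' : Measure Ω'}
  {d n n' : ℕ}

/-- The mean square of an average of independent copies. -/
lemma integral_norm_sq_average [IsFiniteMeasure P'] {U : Ω → Vec d} {V : Fin n → Ω' → Vec d}
    (hn : 1 ≤ n) (hU : MemLp U 2 P) (hV : ∀ i, IdentDistrib (V i) U P' P)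
    (hind : Pairwise fun i j => IndepFun (V i) (V j) P') :
    ∫ ω, ‖(n : ℝ)⁻¹ • ∑ i, V i ω‖ ^ 2 ∂P' = ‖∫ ω, U ω ∂P‖ ^ 2 + vecVar P U / n := by
  have hL : ∀ i, MemLp (V i) 2 P' := fun i => (hV i).symm.memLp_iff.1 hU
  have hE : ∀ i, ∫ ω, V i ω ∂P' = ∫ ω, U ω ∂P := fun i => (hV i).integral_eq
  have hint : ∀ i j, Integrable (fun ω => (inner ℝ (V i ω) (V j ω) : ℝ)) P' := fun i j =>
    ((hL i).norm.integrable_mul (hL j).norm).mono' ((hL i).1.inner (hL j).1)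
      (.of_forall fun ω => abs_real_inner_le_norm _ _)
  -- Among the `n²` inner products all contribute `‖E U‖²`, and only the `n` diagonal ones add the
  -- variance; hence the factor `1/n`.
  have hij : ∀ i j, ∫ ω, (inner ℝ (V i ω) (V j ω) : ℝ) ∂P' =
      ‖∫ ω, U ω ∂P‖ ^ 2 + if i = j then vecVar P U else 0 := by
    intro i j
    split_ifs with h
    · subst h
      simp only [real_inner_self_eq_norm_sq, vecVar, add_sub_cancel]
      exact ((hV i).comp (u := fun v : Vec d => ‖v‖ ^ 2) (by fun_prop)).integral_eq
    · have : ∫ ω, (inner ℝ (V i ω) (V j ω) : ℝ) ∂P' =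
          inner ℝ (∫ ω, V i ω ∂P') (∫ ω, V j ω ∂P') :=
        (hind h).integral_bilin ((hL i).integrable one_le_two)
          ((hL j).integrable one_le_two) (innerSL ℝ)
      rw [this, hE, hE, real_inner_self_eq_norm_sq, add_zero]
  have e : (fun ω => ‖(n : ℝ)⁻¹ • ∑ i, V i ω‖ ^ 2) =
      fun ω => ((n : ℝ)⁻¹) ^ 2 * ∑ i, ∑ j, (inner ℝ (V i ω) (V j ω) : ℝ) := by
    ext ω
    rw [norm_smul, mul_pow, Real.norm_eq_abs, sq_abs, ← real_inner_self_eq_norm_sq, sum_inner]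
    simp only [inner_sum]
  have hn' : (n : ℝ) ≠ 0 := by positivity
  rw [e, integral_const_mul, integral_finsetSum _ fun i _ => integrable_finsetSum _ fun j _ =>
    hint i j]
  simp only [integral_finsetSum _ fun j _ => hint _ j, hij, Finset.sum_add_distrib,
    Finset.sum_const, Finset.card_univ, Fintype.card_fin, Finset.sum_ite_eq, Finset.mem_univ,
    if_true, nsmul_eq_mul]
  field_simp

lemma integral_form {D : Ω' → Vec d} (S : Matrix (Fin d) (Fin d) ℝ)
    (hD : ∀ i j, Integrable (fun ω => D ω i * D ω j) P') :
    ∫ ω, form S (D ω) (D ω) ∂P' = ∑ i, ∑ j, (∫ ω, D ω i * D ω j ∂P') * S i j := by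
  have e : (fun ω => form S (D ω) (D ω)) = fun ω => ∑ i, ∑ j, D ω i * D ω j * S i j :=
    funext fun ω => form_eq_sum S (D ω) (D ω)
  have h : ∀ i j, Integrable (fun ω => D ω i * D ω j * S i j) P' := fun i j =>
    (hD i j).mul_const _
  rw [e, integral_finsetSum _ fun i _ => integrable_finsetSum _ fun j _ => h i j]
  refine Finset.sum_congr rfl fun i _ => ?_
  rw [integral_finsetSum _ fun j _ => h i j]
  exact Finset.sum_congr rfl fun j _ => integral_mul_const _ _

/-- In coordinates, each term is a product of a function of `D` and a function of `a`; independence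
replaces `a aᵀ` by its mean. -/
lemma integral_inner_sq_of_indepFun {D a : Ω' → Vec d} (hD : MemLp D 2 P') (ha : MemLp a 2 P')
    (hi : IndepFun D a P') :
    Integrable (fun ω => (inner ℝ (D ω) (a ω) : ℝ) ^ 2) P' ∧
      ∫ ω, (inner ℝ (D ω) (a ω) : ℝ) ^ 2 ∂P' = ∫ ω, form (hessian P' a) (D ω) (D ω) ∂P' := by
  have e : (fun ω => (inner ℝ (D ω) (a ω) : ℝ) ^ 2) =
      fun ω => ∑ i, ∑ j, (D ω i * D ω j) * (a ω i * a ω j) := by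
    ext ω
    rw [inner_eq_sum, sq, Finset.sum_mul_sum]
    exact Finset.sum_congr rfl fun i _ => Finset.sum_congr rfl fun j _ => by ring
  have hDi : ∀ i j, Integrable (fun ω => D ω i * D ω j) P' := fun i j => by
    simpa using momentExists_one hD i j
  have hai : ∀ i j, Integrable (fun ω => a ω i * a ω j) P' := fun i j => by
    simpa using momentExists_one ha i j
  have hij : ∀ i j, IndepFun (fun ω => D ω i * D ω j) (fun ω => a ω i * a ω j) P' := fun i j =>
    hi.comp (φ := fun v : Vec d => v i * v j) (ψ := fun v : Vec d => v i * v j) (by fun_prop)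
      (by fun_prop)
  have hint : ∀ i j, Integrable (fun ω => (D ω i * D ω j) * (a ω i * a ω j)) P' := fun i j =>
    (hij i j).integrable_mul (hDi i j) (hai i j)
  rw [e]
  refine ⟨integrable_finsetSum _ fun i _ => integrable_finsetSum _ fun j _ => hint i j, ?_⟩
  rw [integral_form _ hDi,
    integral_finsetSum _ fun i _ => integrable_finsetSum _ fun j _ => hint i j]
  refine Finset.sum_congr rfl fun i _ => ?_
  rw [integral_finsetSum _ fun j _ => hint i j]
  refine Finset.sum_congr rfl fun j _ => ?_
  rw [(hij i j).integral_fun_mul_eq_mul_integral (hDi i j).1 (hai i j).1]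
  simp [hessian, momentMatrix]

variable {Ω₀ : Type*} [MeasurableSpace Ω₀] {P₀ : Measure Ω₀} {x : Ω₀ → Vec d} {Z : Ω → Vec d}
  {Zc : Fin n → Ω' → Vec d} {xc : Fin n' → Ω' → Vec d}

lemma IsSample.hessian_eq (h : IsSample P₀ P P' x Z Zc xc) (j : Fin n') :
    hessian P' (xc j) = hessian P₀ x :=
  hessian_congr (y := fun _ => 0) (b := fun _ => 0)
    ((h.copies_x j).comp (u := fun v : Vec d => (v, (0 : ℝ))) (by fun_prop))

lemma IsSample.memLp_average (h : IsSample P₀ P P' x Z Zc xc) (hZ : MemLp Z 2 P) :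
    MemLp (fun ω => (n : ℝ)⁻¹ • ∑ i, Zc i ω) 2 P' :=
  MemLp.const_smul (f := fun ω => ∑ i, Zc i ω)
    (memLp_finsetSum _ fun i _ => (h.copies_Z i).symm.memLp_iff.1 hZ) (n : ℝ)⁻¹

lemma IsSample.indepFun_average (h : IsSample P₀ P P' x Z Zc xc) (j : Fin n') :
    IndepFun (fun ω => (n : ℝ)⁻¹ • ∑ i, Zc i ω) (xc j) P' := by
  have hm : ∀ t, AEMeasurable (Sum.elim Zc xc t) P' := by
    rintro (i | i)
    · exact (h.copies_Z i).aemeasurable_fst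
    · exact (h.copies_x i).aemeasurable_fst
  refine indepFun_of_dependsOn h.indep hm (t := Sum.inr j)
    (S := Finset.univ.map Function.Embedding.inl)
    (f := fun p : Fin n ⊕ Fin n' → Vec d => (n : ℝ)⁻¹ • ∑ i, p (Sum.inl i)) (by simp)
    (by fun_prop) fun p q hpq => ?_
  have : ∀ i, p (Sum.inl i) = q (Sum.inl i) := fun i => hpq _ (by simp)
  simp only [this]

/-- Each of the `n'` summands has mean `E‖√H Z̄‖²`, so `n'` drops out; the average formula then
applies to the copies of `√H Z`. -/
lemma IsSample.integral_sqBiasEstimator [IsFiniteMeasure P] [IsProbabilityMeasure P']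
    (hn : 1 ≤ n) (hn' : 1 ≤ n')
    (h : IsSample P₀ P P' x Z Zc xc) (hx : MemLp x 2 P₀) (hZ : MemLp Z 2 P)
    (hH : (hessian P₀ x).PosSemidef) :
    Integrable (fun ω => sqBiasEstimator (fun i => Zc i ω) (fun j => xc j ω)) P' ∧
      ∫ ω, sqBiasEstimator (fun i => Zc i ω) (fun j => xc j ω) ∂P' =
        wnorm (hessian P₀ x) (∫ ω, Z ω ∂P) ^ 2 + wvar P (hessian P₀ x) Z / n := by
  have h1 := fun j => integral_inner_sq_of_indepFun (h.memLp_average hZ)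
    ((h.copies_x j).symm.memLp_iff.1 hx) (h.indepFun_average j)
  refine ⟨(integrable_finsetSum _ fun j _ => (h1 j).1).const_mul _, ?_⟩
  let L := sqrtMulL (hessian P₀ x)
  have hLm : Measurable L := L.continuous.measurable
  have h2 : ∫ ω, form (hessian P₀ x) ((n : ℝ)⁻¹ • ∑ i, Zc i ω) ((n : ℝ)⁻¹ • ∑ i, Zc i ω) ∂P' =
      wnorm (hessian P₀ x) (∫ ω, Z ω ∂P) ^ 2 + wvar P (hessian P₀ x) Z / n := by
    have h3 := integral_norm_sq_average (U := fun ω => L (Z ω)) (V := fun i ω => L (Zc i ω)) hn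
      (L.comp_memLp' hZ) (fun i => (h.copies_Z i).comp hLm)
      (fun i j hij => (h.indep.indepFun (i := Sum.inl i) (j := Sum.inl j)
        (by simpa using hij)).comp hLm hLm)
    rw [L.integral_comp_comm (hZ.integrable one_le_two)] at h3
    simp only [← map_sum, ← map_smul] at h3
    simp only [← norm_sqrtMul_sq hH]
    exact h3
  simp only [sqBiasEstimator]
  rw [integral_const_mul, integral_finsetSum _ fun j _ => (h1 j).1]
  simp only [(h1 _).2, h.hessian_eq, h2, Finset.sum_const, Finset.card_univ, Fintype.card_fin,
    nsmul_eq_mul]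
  have : (n' : ℝ) ≠ 0 := by positivity
  field_simp

lemma wnorm_sub_comm (S : Matrix (Fin d) (Fin d) ℝ) (u v : Vec d) :
    wnorm S (u - v) = wnorm S (v - u) := by
  simp only [wnorm, ← sqrtMulL_apply, map_sub]
  exact norm_sub_rev _ _

end Sample

end LeastSquaresSGD

theorem mainTheorem7
    {Ω₀ : Type*} [MeasurableSpace Ω₀] (P₀ : Measure Ω₀) [IsProbabilityMeasure P₀]
    {Ω : Type*} [MeasurableSpace Ω] (P : Measure Ω) [IsProbabilityMeasure P]
    {d : ℕ} (x : Ω₀ → Vec d) (y : Ω₀ → ℝ) (θstar θ₀ : Vec d) (σ R γ δ : ℝ)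
    (hreg : IsRegression P₀ x y θstar σ R)
    (hγ0 : 0 < γ) (hγ : γ < 2 / R ^ 2) (hδ : 1 < δ)
    (k s : ℕ) (hk : 2 ≤ k) (hs : s < k)
    (xs : ℤ → Ω → Vec d) (ys : ℤ → Ω → ℝ) (τ : ℕ → Ω → ℕ) (N : Ω → ℕ)
    (hin : IsInput P₀ P x y s k δ xs ys τ N)
    (θbar : Ω → Vec d)
    (hθbar : θbar = fun ω => timeAverage γ θ₀ s k (fun t => xs t ω) (fun t => ys t ω))
    (Z : Ω → Vec d) (hZ : Z = singleTerm γ θ₀ δ xs ys τ N)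
    (H : Matrix (Fin d) (Fin d) ℝ) (hH : H = hessian P₀ x) :
    Integrable θbar P ∧ MemLp Z 2 P ∧ 0 ≤ wvar P H Z ∧
    (∀ n n' : ℕ, 1 ≤ n → 1 ≤ n' →
      ∀ (Ω' : Type*) [MeasurableSpace Ω'] (P' : Measure Ω') [IsProbabilityMeasure P']
        (Zc : Fin n → Ω' → Vec d) (xc : Fin n' → Ω' → Vec d),
        IsSample P₀ P P' x Z Zc xc →
        Integrable (fun ω => sqBiasEstimator (fun i => Zc i ω) (fun j => xc j ω)) P' ∧
        ∫ ω, sqBiasEstimator (fun i => Zc i ω) (fun j => xc j ω) ∂P' =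
          wnorm H ((∫ ω, θbar ω ∂P) - θstar) ^ 2 + wvar P H Z / n) ∧
    (∀ ε : ℝ, 0 < ε → ∃ n₀ : ℕ, 1 ≤ n₀ ∧ ∀ n n' : ℕ, n₀ ≤ n → 1 ≤ n' →
      ∀ (Ω' : Type*) [MeasurableSpace Ω'] (P' : Measure Ω') [IsProbabilityMeasure P']
        (Zc : Fin n → Ω' → Vec d) (xc : Fin n' → Ω' → Vec d),
        IsSample P₀ P P' x Z Zc xc →
        |(∫ ω, sqBiasEstimator (fun i => Zc i ω) (fun j => xc j ω) ∂P') -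
          wnorm H ((∫ ω, θbar ω ∂P) - θstar) ^ 2| < ε) := by
  subst hθbar hZ hH
  have hL := hin.memLp_singleTerm (θ₀ := θ₀) hreg hγ0 hγ hδ hs
  have hpsd := hreg.posDef.posSemidef
  have hmean : ∫ ω, singleTerm γ θ₀ δ xs ys τ N ω ∂P =
      θstar - ∫ ω, timeAverage γ θ₀ s k (fun t => xs t ω) (fun t => ys t ω) ∂P := by
    rw [hin.integral_singleTerm hreg hγ0 hγ hδ hs, hin.integral_timeAverage hreg hs]
  have hvar : 0 ≤ wvar P (hessian P₀ x) (singleTerm γ θ₀ δ xs ys τ N) :=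
    vecVar_nonneg ((sqrtMulL (hessian P₀ x)).comp_memLp' hL)
  refine ⟨hin.integrable_timeAverage hreg, hL, hvar, ?_, ?_⟩
  · intro n n' hn hn' Ω' _ P' _ Zc xc h
    -- The mean of `Z` is the bias with the opposite sign, which the norm ignores.
    have h1 := h.integral_sqBiasEstimator hn hn' hreg.memLp_x hL hpsd
    rwa [hmean, wnorm_sub_comm] at h1
  · intro ε hε
    -- The excess is `Var_H(Z)/n`, free of `n'`, so a threshold above `Var_H(Z)/ε` serves every
    -- `n'`.
    obtain ⟨m, hm⟩ := exists_nat_gt (wvar P (hessian P₀ x) (singleTerm γ θ₀ δ xs ys τ N) / ε)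
    refine ⟨m + 1, by omega, fun n n' hn hn' Ω' _ P' _ Zc xc h => ?_⟩
    have h1 := (h.integral_sqBiasEstimator (by omega) hn' hreg.memLp_x hL hpsd).2
    rw [hmean, wnorm_sub_comm] at h1
    have hn0 : (0 : ℝ) < n := by
      exact_mod_cast (by omega : 0 < n)
    have hmn : (m : ℝ) ≤ n := by
      exact_mod_cast (by omega : m ≤ n)
    rw [h1, add_sub_cancel_left, abs_of_nonneg (by positivity), div_lt_iff₀ hn0, ← div_lt_iff₀' hε]
    exact hm.trans_le hmn
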